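/- Let $d\in\mathbb N$ and let $(p_t)_{t>0}$ be a convolution semigroup of symmetric probability densities on $\mathbb R^d$: each $p_t\ge 0$ is Borel with $\int p_t\,dx=1$, $p_t(-x)=p_t(x)$ and $p_{s+t}=p_s*p_t$ for almost every $x$ and all $s,t>0$, and $\int_{\|x\|\ge r}p_t\,dx\to0$ as $t\downarrow0$ for every $r>0$. Write $p_t(y\mid x)=p_t(y-x)$ and $(T_tf)(x)=\int f(y)\,p_t(y\mid x)\,dy$. Let $\mathcal A$, with domain $\mathcal D(\mathcal A)$, be the infinitesimal generator of $\{T_t\}$ on $L^2(\mathbb R^d,dx)$, that is, $\mathcal Af=\lim_{h\downarrow0}(T_hf-f)/h$ in $L^2$. Fix $c>0$ and a (proper) prior density $\pi$ on $\mathbb R^d$, i.e. a Borel function $\pi\ge0$ with $\int\pi\,d\theta=1$, and let $$M^\pi(x)=M^\pi(x;c)=\int_{\mathbb R^d}p_c(x\mid\theta)\,\pi(\theta)\,d\theta .$$ For $h>0$, $\varepsilon>0$ and $g\in\mathcal D_+(\mathcal A)=\{g\in\mathcal D(\mathcal A): g\ge0\text{ a.e.}\}$ put $$\varphi(h,g,\varepsilon)=\int_{\mathbb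 R^d}\log\frac{g(x)+\varepsilon}{(T_hg)(x)+\varepsilon}\,M^\pi(x)\,dx ,$$ and define the rate functional $$I(M^\pi)=\sup_{u,\ \varepsilon>0}\int_{\mathbb R^d}\frac{(-\mathcal Au_\varepsilon)(x)}{u_\varepsilon(x)}\,M^\pi(x)\,dx ,\qquad u_\varepsilon=u+\varepsilon,\quad \mathcal Au_\varepsilon=\mathcal Au,$$ where $u$ runs over the bounded non-negative Borel functions on $\mathbb R^d$ that belong to $\mathcal D(\mathcal A)$. Integrals are taken in $[-\infty,\infty]$, and in both suprema a pair for which the integral is not defined (positive and negative parts both of infinite integral) is disregarded. Theorem. In $[0,\infty]$, $$\lim_{h\downarrow0}\frac1h\sup_{g\in\mathcal D_+(\mathcal A),\ \varepsilon>0}\varphi(h,g,\varepsilon)=I(M^\pi).$$ In particular the limit exists, and it is $+\infty$ if and only if $I(M^\pi)=+\infty$. -/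

import Mathlib

open MeasureTheory Filter Topology

noncomputable section

/-- The integral of `f` as an extended real number, `∫ f⁺ - ∫ f⁻`.  It is the usual integral for
integrable `f`, it is `+∞` or `-∞` if exactly one of the two parts has infinite integral, and,
since `⊤ - ⊤ = ⊥` in `EReal`, it is `-∞` where the integral is not defined, so that such an
`f` is disregarded in a supremum. -/
def extIntegral {α : Type*} [MeasurableSpace α] (μ : Measure α) (f : α → ℝ) : EReal :=
  ((∫⁻ x, ENNReal.ofReal (f x) ∂μ : ENNReal) : EReal) -
    ((∫⁻ x, ENNReal.ofReal (-f x) ∂μ : ENNReal) : EReal)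

/-- A (weakly continuous) convolution semigroup of symmetric probability densities on `ℝ^d`:
the transition density from `x` to `y` in time `t > 0` is `density t (y - x)`, and for each `c > 0`
the density of the location family with location `θ` and scale `c` is `density c (x - θ)`.
Values at times `t ≤ 0` are irrelevant. -/
structure SymmConvSemigroup (d : ℕ) where
  density : ℝ → EuclideanSpace ℝ (Fin d) → ℝ
  measurable_density : ∀ t, 0 < t → Measurable (density t)
  density_nonneg : ∀ t, 0 < t → ∀ x, 0 ≤ density t x
  integral_density : ∀ t, 0 < t → ∫ x, density t x = 1
  density_neg : ∀ t, 0 < t → ∀ᵐ x, density t (-x) = density t x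
  density_add : ∀ s t, 0 < s → 0 < t →
    ∀ᵐ x, density (s + t) x = ∫ y, density s (x - y) * density t y
  /-- As `t ↓ 0` the laws converge weakly to the Dirac mass at the origin. -/
  tendsto_dirac : ∀ r, 0 < r →
    Tendsto (fun t => ∫ x in {x | r ≤ ‖x‖}, density t x) (𝓝[>] 0) (𝓝 0)

namespace SymmConvSemigroup

variable {d : ℕ} (S : SymmConvSemigroup d)

/-- The Markovian semigroup `(T_t f)(x) = ∫ f(y) p_t(y | x) dy`, `t > 0`. -/
def T (t : ℝ) (f : EuclideanSpace ℝ (Fin d) → ℝ) (x : EuclideanSpace ℝ (Fin d)) : ℝ :=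
  ∫ y, f y * S.density t (y - x)

/-- `f` is in the domain of the infinitesimal generator `𝒜` of `T` on `L²(ℝ^d)`, and `𝒜 f = v`:
`(T_h f - f) / h → v` in `L²` as `h ↓ 0`. -/
def HasGenerator (f v : EuclideanSpace ℝ (Fin d) → ℝ) : Prop :=
  MemLp f 2 volume ∧ MemLp v 2 volume ∧
    Tendsto (fun h : ℝ => eLpNorm (fun x => (S.T h f x - f x) / h - v x) 2 volume)
      (𝓝[>] 0) (𝓝 0)

/-- The domain `𝒟(𝒜)` of the `L²` generator. -/
def domain : Set (EuclideanSpace ℝ (Fin d) → ℝ) := {f | ∃ v, S.HasGenerator f v}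

open Classical in
/-- The `L²` generator `𝒜` (determined up to Lebesgue null sets on its domain; `0` elsewhere). -/
def generator (f : EuclideanSpace ℝ (Fin d) → ℝ) : EuclideanSpace ℝ (Fin d) → ℝ :=
  if hf : ∃ v, S.HasGenerator f v then hf.choose else 0

/-- The non-negative elements of `𝒟(𝒜)`. -/
def domainNonneg : Set (EuclideanSpace ℝ (Fin d) → ℝ) :=
  {g | g ∈ S.domain ∧ 0 ≤ᵐ[volume] g}

/-- The marginal density `M^π(x; c) = ∫ p_c(x | θ) π(θ) dθ` of the observation under the prior
density `π`. -/
def marginal (c : ℝ) (prior : EuclideanSpace ℝ (Fin d) → ℝ) (x : EuclideanSpace ℝ (Fin d)) : ℝ :=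
  ∫ θ, S.density c (x - θ) * prior θ

/-- `φ(h, g, ε) = ∫ log ((g + ε) / (T_h g + ε)) M dx`. -/
def phi (M : EuclideanSpace ℝ (Fin d) → ℝ) (h : ℝ) (g : EuclideanSpace ℝ (Fin d) → ℝ)
    (ε : ℝ) : EReal :=
  extIntegral volume fun x => Real.log ((g x + ε) / (S.T h g x + ε)) * M x

/-- The bounded, non-negative, Borel measurable functions that belong to `𝒟(𝒜)`. -/
def testFunctions : Set (EuclideanSpace ℝ (Fin d) → ℝ) :=
  {u | Measurable u ∧ (∀ x, 0 ≤ u x) ∧ (∃ C, ∀ x, u x ≤ C) ∧ u ∈ S.domain}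

/-- The rate functional `I(M) = sup_{u, ε} ∫ (-𝒜 u_ε) / u_ε M dx` with `u_ε = u + ε`; since
`T_t 1 = 1`, constants are annihilated by the generator and `𝒜 u_ε = 𝒜 u`. -/
def rateFunctional (M : EuclideanSpace ℝ (Fin d) → ℝ) : EReal :=
  ⨆ u ∈ S.testFunctions, ⨆ ε ∈ Set.Ioi (0 : ℝ),
    extIntegral volume fun x => -S.generator u x / (u x + ε) * M x

end SymmConvSemigroup

end

/-! Write `M` for the marginal density; it enters only through `M ≥ 0` and `M ∈ L¹`. The ratio
`supPhi M t / t` is bounded above by the rate functional `I` for every `t > 0`, and below by a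
quantity whose lower limit is at least `I`.

Upper bound. Along an orbit, `s ↦ ∫ log ((u + ε) / (T_s u + ε)) M` vanishes at `0`, and its right
derivative at `s` is at most `∫ (-𝒜 T_s u) / (T_s u + ε) M ≤ I`, because `T_s u` is again an
admissible test function. Integrating gives `I t` (`integral_logRatio_le_of_lipschitz`).
Differentiating under an `L¹` weight needs difference quotients that are bounded pointwise, not
merely convergent in `L²`. Time averages `δ⁻¹ ∫₀^δ T_s f ds` of bounded `f` have this property
(`abs_U_timeAvg_sub_le`). Letting `δ ↓ 0` and then removing a truncation reaches every non-negative
`f ∈ L²` (`extIntegral_logRatio_le`).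

Lower bound. The inequality `log y ≥ 1 - 1 / y` gives `φ(t, u, ε) ≥ ∫ (u - T_t u) / (u + ε) M` when
the integrals exist, but the quotients converge only in `L²`, which does not control an integral
against `M ∈ L¹`. The detour is through the approximate Dirichlet form of `√M`. By symmetry of the
semigroup, `2 ∫ (u - T_t u) / (u + ε) ψ²` is at most the form of `ψ`
(`two_mul_integral_le_dirichlet`). For `ψ = min (√M) n` the weight `ψ² / (u + ε)` lies in `L²`, so
the limit `t ↓ 0` is legitimate, and truncation does not increase the form (`dirichlet_truncLp_le`).
Finally half the form of `√M` is at most `supPhi M t`, by testing with truncations of `√M` itself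
(`dirichlet_le_supPhi`). -/

noncomputable section

open scoped ENNReal

/-! ### Averages of translates as contractions of `L²`. -/

section Averaging

variable {E : Type*} [NormedAddCommGroup E] [NormedSpace ℝ E] [FiniteDimensional ℝ E]
  [MeasureSpace E] [BorelSpace E] [(volume : Measure E).IsAddHaarMeasure]

/-- The map `(x, z) ↦ x + z` sends `dx ⊗ P` to Lebesgue measure. -/
theorem measurePreserving_add_prod_right (P : Measure E) [IsProbabilityMeasure P] :
    MeasurePreserving (fun q : E × E => q.1 + q.2) ((volume : Measure E).prod P) volume := by
  have h1 : MeasurePreserving (fun q : E × E => (q.1, q.2 + q.1)) (P.prod (volume : Measure E))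
      (P.prod volume) :=
    (MeasurePreserving.id P).skew_product (g := fun z x => x + z)
      (measurable_snd.add measurable_fst)
      (Eventually.of_forall fun z => map_add_right_eq_self volume z)
  exact (measurePreserving_snd.comp h1).comp Measure.measurePreserving_swap

/-- The flip `(x, y) ↦ (y, x)`, in the coordinates `(x, y - x)`, preserves `dx ⊗ P` for
symmetric `P`. -/
theorem measurePreserving_flip (P : Measure E) [IsProbabilityMeasure P]
    (hP : P.map (fun z => -z) = P) :
    MeasurePreserving (fun q : E × E => (q.1 + q.2, -q.2)) ((volume : Measure E).prod P)
      (volume.prod P) := by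
  have h1 : MeasurePreserving (fun q : E × E => (-q.1, q.2 + q.1)) (P.prod (volume : Measure E))
      (P.prod volume) :=
    MeasurePreserving.skew_product (f := fun z : E => -z) (g := fun z x => x + z)
      ⟨measurable_neg, hP⟩ (measurable_snd.add measurable_fst)
      (Eventually.of_forall fun z => map_add_right_eq_self volume z)
  exact (Measure.measurePreserving_swap.comp h1).comp Measure.measurePreserving_swap

/-- Jensen's inequality: averaging one variable out against a probability measure is a contraction
of `L²`. -/
theorem eLpNorm_integral_prod_le {α β : Type*} [MeasurableSpace α] [MeasurableSpace β]
    (μ : Measure α) [SFinite μ] (P : Measure β) [IsProbabilityMeasure P] {F : α × β → ℝ}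
    (hF : AEStronglyMeasurable F (μ.prod P)) :
    eLpNorm (fun x => ∫ z, F (x, z) ∂P) 2 μ ≤ eLpNorm F 2 (μ.prod P) := by
  have key : ∀ᵐ x ∂μ, ‖∫ z, F (x, z) ∂P‖ₑ ^ (2 : ℝ) ≤ ∫⁻ z, ‖F (x, z)‖ₑ ^ (2 : ℝ) ∂P := by
    filter_upwards [hF.prodMk_left] with x hx
    have h1 : ‖∫ z, F (x, z) ∂P‖ₑ ≤ eLpNorm (fun z => F (x, z)) 2 P := by
      refine (enorm_integral_le_lintegral_enorm _).trans ?_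
      rw [← eLpNorm_one_eq_lintegral_enorm]
      exact eLpNorm_le_eLpNorm_of_exponent_le (by norm_num) hx
    calc _ ≤ eLpNorm (fun z => F (x, z)) 2 P ^ (2 : ℝ) := by gcongr
      _ = _ := by
        rw [eLpNorm_eq_lintegral_rpow_enorm_toReal (by norm_num) (by norm_num),
          ← ENNReal.rpow_mul]
        simp
  rw [eLpNorm_eq_lintegral_rpow_enorm_toReal (by norm_num) (by norm_num),
    eLpNorm_eq_lintegral_rpow_enorm_toReal (by norm_num) (by norm_num)]
  simp only [ENNReal.toReal_ofNat]
  gcongr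
  rw [lintegral_prod _ (hF.enorm.pow_const _)]
  exact lintegral_mono_ae key

/-- The average `∫ f (x + z) dP(z)` of the translates of `f`. -/
def translateAvg (P : Measure E) (f : E → ℝ) (x : E) : ℝ := ∫ z, f (x + z) ∂P

theorem memLp_comp_add (P : Measure E) [IsProbabilityMeasure P] {p : ℝ≥0∞} {f : E → ℝ}
    (hf : MemLp f p volume) :
    MemLp (fun q : E × E => f (q.1 + q.2)) p ((volume : Measure E).prod P) :=
  hf.comp_measurePreserving (measurePreserving_add_prod_right P)

theorem eLpNorm_translateAvg_le (P : Measure E) [IsProbabilityMeasure P] {f : E → ℝ}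
    (hf : MemLp f 2 volume) : eLpNorm (translateAvg P f) 2 volume ≤ eLpNorm f 2 volume := by
  refine (eLpNorm_integral_prod_le volume P (memLp_comp_add P hf).1).trans ?_
  exact (eLpNorm_comp_measurePreserving hf.1 (measurePreserving_add_prod_right P)).le

theorem memLp_translateAvg (P : Measure E) [IsProbabilityMeasure P] {f : E → ℝ}
    (hf : MemLp f 2 volume) : MemLp (translateAvg P f) 2 volume :=
  ⟨(memLp_comp_add P hf).1.integral_prod_right', (eLpNorm_translateAvg_le P hf).trans_lt hf.2⟩

theorem ae_integrable_translate (P : Measure E) [IsProbabilityMeasure P] {f : E → ℝ}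
    (hf : MemLp f 2 volume) : ∀ᵐ x : E, Integrable (fun z => f (x + z)) P := by
  have h := (memLp_comp_add P hf)
  have h2 : Integrable (fun q : E × E => f (q.1 + q.2) ^ 2) ((volume : Measure E).prod P) :=
    h.integrable_sq
  filter_upwards [h2.prod_right_ae, h.1.prodMk_left] with x hx hm
  exact ((memLp_two_iff_integrable_sq hm).2 hx).integrable (by norm_num)

theorem ae_ae_add {P : Measure E} [IsProbabilityMeasure P] {p : E → Prop}
    (h : ∀ᵐ x : E, p x) : ∀ᵐ x : E, ∀ᵐ z ∂P, p (x + z) :=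
  Measure.ae_ae_of_ae_prod ((measurePreserving_add_prod_right P).quasiMeasurePreserving.ae h)

theorem translateAvg_congr {P : Measure E} [IsProbabilityMeasure P] {f g : E → ℝ}
    (h : f =ᵐ[volume] g) : translateAvg P f =ᵐ[volume] translateAvg P g := by
  filter_upwards [ae_ae_add (P := P) h] with x hx
  exact integral_congr_ae hx

/-- Averaging of translates as a contraction of `L²`. -/
def avgLp (P : Measure E) [IsProbabilityMeasure P] :
    Lp ℝ 2 (volume : Measure E) →L[ℝ] Lp ℝ 2 (volume : Measure E) :=
  LinearMap.mkContinuous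
    { toFun := fun f => (memLp_translateAvg P (Lp.memLp f)).toLp
      map_add' := fun f g => by
        rw [← MemLp.toLp_add, MemLp.toLp_eq_toLp_iff]
        filter_upwards [translateAvg_congr (P := P) (Lp.coeFn_add f g),
          ae_integrable_translate P (Lp.memLp f), ae_integrable_translate P (Lp.memLp g)]
          with x hx hf hg
        rw [hx]
        exact integral_add hf hg
      map_smul' := fun c f => by
        rw [← MemLp.toLp_const_smul, MemLp.toLp_eq_toLp_iff]
        filter_upwards [translateAvg_congr (P := P) (Lp.coeFn_smul c f)] with x hx
        rw [hx]
        exact integral_smul c _ }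
    1 fun f => by
      rw [one_mul, Lp.norm_def, Lp.norm_def]
      simp only [LinearMap.coe_mk, AddHom.coe_mk]
      rw [eLpNorm_congr_ae (MemLp.coeFn_toLp _)]
      exact ENNReal.toReal_mono (Lp.memLp f).2.ne (eLpNorm_translateAvg_le P (Lp.memLp f))

theorem coeFn_avgLp (P : Measure E) [IsProbabilityMeasure P] (f : Lp ℝ 2 (volume : Measure E)) :
    avgLp P f =ᵐ[volume] translateAvg P f :=
  MemLp.coeFn_toLp (memLp_translateAvg P (Lp.memLp f))

theorem norm_avgLp_le (P : Measure E) [IsProbabilityMeasure P] : ‖avgLp P‖ ≤ 1 :=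
  LinearMap.mkContinuous_norm_le _ zero_le_one _

theorem avgLp_dirac_zero : avgLp (Measure.dirac (0 : E)) = 1 := by
  ext1 f
  apply Lp.ext
  filter_upwards [coeFn_avgLp (Measure.dirac (0 : E)) f] with x hx
  rw [hx]
  simp [translateAvg]

theorem avgLp_conv (P Q : Measure E) [IsProbabilityMeasure P] [IsProbabilityMeasure Q]
    [IsProbabilityMeasure (P ∗ Q)] : avgLp (P ∗ Q) = avgLp P * avgLp Q := by
  ext1 f
  apply Lp.ext
  have h := memLp_comp_add P (f := fun x : E => f x) (p := 2) (Lp.memLp f)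
  filter_upwards [coeFn_avgLp (P ∗ Q) f, coeFn_avgLp P (avgLp Q f),
    translateAvg_congr (P := P) (coeFn_avgLp Q f), ae_integrable_translate (P ∗ Q) (Lp.memLp f)]
    with x h1 h2 h3 h4
  rw [h1, mul_apply_eq_comp, h2, h3]
  simp only [translateAvg]
  have h5 : Integrable (fun q : E × E => f (x + (q.1 + q.2))) (P.prod Q) := by
    rw [Measure.conv] at h4
    exact h4.comp_measurable (f := fun q : E × E => q.1 + q.2) (by fun_prop)
  rw [Measure.conv] at h4 ⊢
  rw [integral_map (by fun_prop) h4.1, integral_prod _ h5]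
  simp only [add_assoc]

/-- A probability average of values in a closed interval stays there. This keeps the bounds `0 ≤ f ≤
C` along whole orbits. -/
theorem avgLp_mem_Icc (P : Measure E) [IsProbabilityMeasure P]
    {f : Lp ℝ 2 (volume : Measure E)} {a b : ℝ} (hf : ∀ᵐ x, f x ∈ Set.Icc a b) :
    ∀ᵐ x, avgLp P f x ∈ Set.Icc a b := by
  filter_upwards [coeFn_avgLp P f, ae_ae_add (P := P) hf, ae_integrable_translate P (Lp.memLp f)]
    with x hx h1 h2
  rw [hx]
  exact (convex_Icc a b).integral_mem isClosed_Icc h1 h2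

theorem avgLp_mono (P : Measure E) [IsProbabilityMeasure P]
    {f g : Lp ℝ 2 (volume : Measure E)} (h : f ≤ᵐ[volume] g) :
    avgLp P f ≤ᵐ[volume] avgLp P g := by
  filter_upwards [coeFn_avgLp P f, coeFn_avgLp P g, ae_ae_add (P := P) h,
    ae_integrable_translate P (Lp.memLp f), ae_integrable_translate P (Lp.memLp g)]
    with x hx hy h1 h2 h3
  rw [hx, hy]
  exact integral_mono_ae h2 h3 h1

theorem avgLp_nonneg (P : Measure E) [IsProbabilityMeasure P]
    {f : Lp ℝ 2 (volume : Measure E)} (h : 0 ≤ᵐ[volume] f) :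
    0 ≤ᵐ[volume] avgLp P f := by
  filter_upwards [coeFn_avgLp P f, ae_ae_add (P := P) h] with x hx h1
  rw [hx]
  exact integral_nonneg_of_ae h1

/-- Averages against probability measures that concentrate at the origin converge strongly
in `L²`. -/
theorem tendsto_avgLp {ι : Type*} {l : Filter ι} (P : ι → Measure E)
    [∀ i, IsProbabilityMeasure (P i)]
    (hP : ∀ r, 0 < r → Tendsto (fun i => P i {x | r ≤ ‖x‖}) l (𝓝 0))
    (f : Lp ℝ 2 (volume : Measure E)) : Tendsto (fun i => avgLp (P i) f) l (𝓝 f) := by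
  -- `k` is the `L²` modulus of continuity of `f` under translation: it is bounded by `2 ‖f‖` and
  -- tends to `0` at the origin. Jensen and Tonelli reduce the claim to `∫ k² dP_i → 0`.
  set k : E → ℝ≥0∞ := fun z => eLpNorm (fun x => f (x + z) - f x) 2 volume with hk
  have hmp (z : E) : MeasurePreserving (fun x : E => x + z) volume volume :=
    measurePreserving_add_right volume z
  have hk_enorm (z : E) : k z = ‖Lp.compMeasurePreserving _ (hmp z) f - f‖ₑ := by
    rw [Lp.enorm_def, hk]
    refine eLpNorm_congr_ae ?_
    filter_upwards [Lp.coeFn_sub (Lp.compMeasurePreserving _ (hmp z) f) f,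
      Lp.coeFn_compMeasurePreserving f (hmp z)] with x h1 h2
    rw [h1, Pi.sub_apply, h2]; rfl
  have hk_tendsto : Tendsto k (𝓝 0) (𝓝 0) := by
    have hc : Tendsto (fun z : E => Lp.compMeasurePreserving _ (hmp z) f) (𝓝 0)
        (𝓝 (Lp.compMeasurePreserving _ (hmp 0) f)) := by
      refine Filter.Tendsto.compMeasurePreservingLp (g := fun z => ⟨fun x : E => x + z, by fun_prop⟩)
        (g₀ := ⟨fun x : E => x + 0, by fun_prop⟩) tendsto_const_nhds ?_ hmp (hmp 0) (by norm_num)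
      have : Continuous fun z : E => (⟨fun x : E => x + z, by fun_prop⟩ : C(E, E)) :=
        ContinuousMap.continuous_of_continuous_uncurry _
          (by simp only [Function.uncurry_def, ContinuousMap.coe_mk]; fun_prop)
      exact this.tendsto 0
    have h0 : Lp.compMeasurePreserving _ (hmp 0) f = f := by
      apply Lp.ext
      filter_upwards [Lp.coeFn_compMeasurePreserving f (hmp 0)] with x hx
      rw [hx]; simp
    rw [h0] at hc
    have h2 := ((continuous_enorm.tendsto _).comp (hc.sub_const f))
    rw [sub_self, enorm_zero] at h2
    exact h2.congr fun z => (hk_enorm z).symm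
  have hk_le (z : E) : k z ≤ 2 * ‖f‖ₑ := by
    rw [hk_enorm, two_mul]
    refine (enorm_sub_le).trans (add_le_add_left (le_of_eq ?_) _)
    rw [Lp.enorm_def, Lp.enorm_def, eLpNorm_congr_ae (Lp.coeFn_compMeasurePreserving f (hmp z))]
    exact eLpNorm_comp_measurePreserving (Lp.memLp f).1 (hmp z)
  have hbound (i : ι) : ‖avgLp (P i) f - f‖ₑ ^ (2 : ℝ) ≤ ∫⁻ z, k z ^ (2 : ℝ) ∂(P i) := by
    have hF : AEStronglyMeasurable (fun q : E × E => f (q.1 + q.2) - f q.1)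
        ((volume : Measure E).prod (P i)) :=
      (memLp_comp_add (P i) (Lp.memLp f)).1.sub (Lp.memLp f).1.comp_fst
    have h1 : ‖avgLp (P i) f - f‖ₑ ≤ eLpNorm (fun q : E × E => f (q.1 + q.2) - f q.1) 2
        ((volume : Measure E).prod (P i)) := by
      rw [Lp.enorm_def]
      refine le_trans (le_of_eq (eLpNorm_congr_ae ?_)) (eLpNorm_integral_prod_le volume (P i) hF)
      filter_upwards [Lp.coeFn_sub (avgLp (P i) f) f, coeFn_avgLp (P i) f,
        ae_integrable_translate (P i) (Lp.memLp f)] with x h1 h2 h3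
      rw [h1, Pi.sub_apply, h2, integral_sub h3 (integrable_const _)]
      simp [translateAvg]
    calc _ ≤ (eLpNorm (fun q : E × E => f (q.1 + q.2) - f q.1) 2
        ((volume : Measure E).prod (P i))) ^ (2 : ℝ) := by gcongr
      _ = ∫⁻ q, ‖f (q.1 + q.2) - f q.1‖ₑ ^ (2 : ℝ) ∂((volume : Measure E).prod (P i)) := by
        rw [eLpNorm_eq_lintegral_rpow_enorm_toReal (by norm_num) (by norm_num),
          ← ENNReal.rpow_mul]
        simp
      _ = ∫⁻ z, ∫⁻ x, ‖f (x + z) - f x‖ₑ ^ (2 : ℝ) ∂(volume : Measure E) ∂(P i) :=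
        lintegral_prod_symm _ (hF.enorm.pow_const _)
      _ = _ := by
        refine lintegral_congr fun z => ?_
        simp only [hk]
        rw [eLpNorm_eq_lintegral_rpow_enorm_toReal (by norm_num) (by norm_num),
          ← ENNReal.rpow_mul]
        simp
  -- Near the origin `k²` is small; away from it `k²` is bounded and `P i` has vanishing mass.
  have hlim : Tendsto (fun i => ∫⁻ z, k z ^ (2 : ℝ) ∂(P i)) l (𝓝 0) := by
    rw [ENNReal.tendsto_nhds_zero]
    intro ε hε
    have hk2 : Tendsto (fun z => k z ^ (2 : ℝ)) (𝓝 0) (𝓝 0) := by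
      have := (ENNReal.continuous_rpow_const (y := 2)).tendsto 0 |>.comp hk_tendsto
      simpa [Function.comp_def] using this
    have hε2 : 0 < ε / 2 := by simpa using hε.ne'
    obtain ⟨r, hr, hball⟩ := Metric.eventually_nhds_iff.1
      ((ENNReal.tendsto_nhds_zero.1 hk2) (ε / 2) hε2)
    set B : ℝ≥0∞ := (2 * ‖f‖ₑ) ^ (2 : ℝ) with hB
    have hBtop : B ≠ ∞ := by
      rw [hB]; exact ENNReal.rpow_ne_top_of_nonneg (by norm_num) (by finiteness)
    have h3 : Tendsto (fun i => B * P i {x | r ≤ ‖x‖}) l (𝓝 0) := by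
      have := ENNReal.Tendsto.const_mul (hP r hr) (Or.inr hBtop)
      simpa using this
    filter_upwards [(ENNReal.tendsto_nhds_zero.1 h3) (ε / 2) hε2] with i hi
    have hS : MeasurableSet {x : E | r ≤ ‖x‖} := measurableSet_le measurable_const measurable_norm
    calc ∫⁻ z, k z ^ (2 : ℝ) ∂(P i)
        ≤ ∫⁻ z, (ε / 2 + Set.indicator {x : E | r ≤ ‖x‖} (fun _ => B) z) ∂(P i) := by
          refine lintegral_mono fun z => ?_
          by_cases hz : r ≤ ‖z‖
          · rw [Set.indicator_of_mem (by exact hz)]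
            refine le_add_left ?_
            exact ENNReal.rpow_le_rpow (hk_le z) (by norm_num)
          · refine le_add_right (hball ?_)
            simpa using hz
      _ = ε / 2 + B * P i {x | r ≤ ‖x‖} := by
          rw [lintegral_add_left measurable_const, lintegral_indicator_const hS]
          simp
      _ ≤ ε / 2 + ε / 2 := by gcongr
      _ = ε := ENNReal.add_halves ε
  rw [tendsto_iff_norm_sub_tendsto_zero]
  have h4 : Tendsto (fun i => ‖avgLp (P i) f - f‖ₑ ^ (2 : ℝ)) l (𝓝 0) :=
    tendsto_of_tendsto_of_tendsto_of_le_of_le tendsto_const_nhds hlim (fun _ => zero_le) hbound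
  have h5 := (ENNReal.continuous_rpow_const (y := 1 / 2)).tendsto 0 |>.comp h4
  have h6 : Tendsto (fun i => ‖avgLp (P i) f - f‖ₑ) l (𝓝 0) := by
    have h0 : ((0 : ℝ≥0∞) ^ (1 / 2 : ℝ)) = 0 := by simp
    rw [h0] at h5
    refine h5.congr fun i => ?_
    simp only [Function.comp_apply]
    rw [← ENNReal.rpow_mul]; norm_num
  have h7 := (ENNReal.tendsto_toReal ENNReal.zero_ne_top).comp h6
  simpa [Function.comp_def] using h7

end Averaging

/-! ### The strongly continuous contraction semigroup on `L²`. -/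

namespace SymmConvSemigroup

variable {d : ℕ} (S : SymmConvSemigroup d)

/-- The law at time `t`, extended by the Dirac mass at the origin to `t ≤ 0`. -/
def law (t : ℝ) : Measure (EuclideanSpace ℝ (Fin d)) :=
  if 0 < t then volume.withDensity fun z => ENNReal.ofReal (S.density t z) else Measure.dirac 0

theorem law_of_pos {t : ℝ} (ht : 0 < t) :
    S.law t = volume.withDensity fun z => ENNReal.ofReal (S.density t z) := if_pos ht

theorem law_of_nonpos {t : ℝ} (ht : t ≤ 0) : S.law t = Measure.dirac 0 := if_neg ht.not_gt

theorem integrable_density {t : ℝ} (ht : 0 < t) : Integrable (S.density t) :=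
  Integrable.of_integral_ne_zero (by rw [S.integral_density t ht]; exact one_ne_zero)

instance isProbabilityMeasure_law (t : ℝ) : IsProbabilityMeasure (S.law t) := by
  rcases lt_or_ge 0 t with ht | ht
  · refine ⟨?_⟩
    rw [S.law_of_pos ht, withDensity_apply _ MeasurableSet.univ, Measure.restrict_univ,
      ← ofReal_integral_eq_lintegral_ofReal (S.integrable_density ht)
        (Eventually.of_forall (S.density_nonneg t ht)), S.integral_density t ht, ENNReal.ofReal_one]
  · rw [S.law_of_nonpos ht]; infer_instance

theorem integral_law {t : ℝ} (ht : 0 < t) (f : EuclideanSpace ℝ (Fin d) → ℝ) :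
    ∫ z, f z ∂(S.law t) = ∫ z, f z * S.density t z := by
  rw [S.law_of_pos ht, integral_withDensity_eq_integral_toReal_smul
    (S.measurable_density t ht).ennreal_ofReal (Eventually.of_forall fun _ => ENNReal.ofReal_lt_top)]
  refine integral_congr_ae (Eventually.of_forall fun z => ?_)
  simp [ENNReal.toReal_ofReal (S.density_nonneg t ht z), mul_comm]

theorem T_eq_translateAvg {t : ℝ} (ht : 0 < t) (f : EuclideanSpace ℝ (Fin d) → ℝ) :
    S.T t f = translateAvg (S.law t) f := by
  ext x
  rw [T, translateAvg, S.integral_law ht, ← integral_add_left_eq_self _ x]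
  simp

/-- Symmetry of the densities in the form required by `measurePreserving_flip`; it is what makes the
approximate Dirichlet form available. -/
theorem map_neg_law (t : ℝ) : (S.law t).map (fun z => -z) = S.law t := by
  rcases lt_or_ge 0 t with ht | ht
  · ext s hs
    rw [Measure.map_apply measurable_neg hs, S.law_of_pos ht, withDensity_apply _ hs,
      withDensity_apply _ (measurable_neg hs)]
    rw [← (Measure.measurePreserving_neg
      (volume : Measure (EuclideanSpace ℝ (Fin d)))).setLIntegral_comp_preimage hs
      (S.measurable_density t ht).ennreal_ofReal]
    refine lintegral_congr_ae (ae_restrict_of_ae ?_)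
    filter_upwards [S.density_neg t ht] with x hx
    rw [hx]
  · rw [S.law_of_nonpos ht, Measure.map_dirac' measurable_neg]; simp

theorem law_add {s t : ℝ} (hs : 0 ≤ s) (ht : 0 ≤ t) : S.law (s + t) = S.law s ∗ S.law t := by
  rcases hs.eq_or_lt with rfl | hs
  · rw [S.law_of_nonpos le_rfl, Measure.dirac_zero_conv, zero_add]
  rcases ht.eq_or_lt with rfl | ht
  · rw [S.law_of_nonpos (t := 0) le_rfl, Measure.conv_dirac_zero, add_zero]
  -- The factors are exchanged so that the convolution integral is taken over the variable of
  -- `density t`, as in `density_add`.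
  rw [Measure.conv_comm, S.law_of_pos hs, S.law_of_pos ht, S.law_of_pos (add_pos hs ht),
    conv_withDensity_eq_lconvolution (S.measurable_density t ht).ennreal_ofReal
      (S.measurable_density s hs).ennreal_ofReal]
  refine withDensity_congr_ae ?_
  have hint := (S.integrable_density ht).convolution_integrand (ContinuousLinearMap.mul ℝ ℝ)
    (S.integrable_density hs)
  filter_upwards [S.density_add s t hs ht, hint.prod_right_ae] with x hx hi
  rw [hx, lconvolution_def]
  simp only [ContinuousLinearMap.mul_apply'] at hi
  simp_rw [mul_comm (S.density s _)]
  rw [ofReal_integral_eq_lintegral_ofReal hi (Eventually.of_forall fun y =>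
    mul_nonneg (S.density_nonneg t ht _) (S.density_nonneg s hs _))]
  refine lintegral_congr fun y => ?_
  rw [ENNReal.ofReal_mul (S.density_nonneg t ht _), neg_add_eq_sub]

theorem tendsto_law (r : ℝ) (hr : 0 < r) :
    Tendsto (fun t => S.law t {x | r ≤ ‖x‖}) (𝓝[>] 0) (𝓝 0) := by
  have h := (ENNReal.continuous_ofReal.tendsto 0).comp (S.tendsto_dirac r hr)
  rw [ENNReal.ofReal_zero] at h
  refine h.congr' ?_
  filter_upwards [self_mem_nhdsWithin] with t ht
  have hS : MeasurableSet {x : EuclideanSpace ℝ (Fin d) | r ≤ ‖x‖} :=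
    measurableSet_le measurable_const measurable_norm
  rw [S.law_of_pos ht, withDensity_apply _ hS, Function.comp_apply,
    ofReal_integral_eq_lintegral_ofReal (S.integrable_density ht).integrableOn
      (Eventually.of_forall (S.density_nonneg t ht))]

/-- The semigroup on `L²`, extended by the identity to `t ≤ 0`. -/
def U (t : ℝ) : Lp ℝ 2 (volume : Measure (EuclideanSpace ℝ (Fin d))) →L[ℝ]
    Lp ℝ 2 (volume : Measure (EuclideanSpace ℝ (Fin d))) := avgLp (S.law t)

theorem U_of_nonpos {t : ℝ} (ht : t ≤ 0) : S.U t = 1 := by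
  -- `avgLp` carries an instance depending on the measure, so the equality of laws is substituted
  -- for a variable `P` rather than rewritten.
  have h : ∀ (P : Measure (EuclideanSpace ℝ (Fin d))) [IsProbabilityMeasure P],
      P = Measure.dirac 0 → avgLp P = 1 := by
    intro P _ hP; subst hP; exact avgLp_dirac_zero
  exact h _ (S.law_of_nonpos ht)

theorem U_add {s t : ℝ} (hs : 0 ≤ s) (ht : 0 ≤ t) : S.U (s + t) = S.U s * S.U t := by
  have h : ∀ (P : Measure (EuclideanSpace ℝ (Fin d))) [IsProbabilityMeasure P],
      P = S.law s ∗ S.law t → avgLp P = S.U s * S.U t := by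
    intro P _ hP; subst hP; exact avgLp_conv _ _
  exact h _ (S.law_add hs ht)

theorem norm_U_le (t : ℝ) : ‖S.U t‖ ≤ 1 := norm_avgLp_le _

theorem norm_U_apply_le (t : ℝ) (f : Lp ℝ 2 (volume : Measure (EuclideanSpace ℝ (Fin d)))) :
    ‖S.U t f‖ ≤ ‖f‖ := by
  simpa using (S.U t).le_of_opNorm_le (S.norm_U_le t) f

theorem coeFn_U {t : ℝ} (ht : 0 < t) {g : EuclideanSpace ℝ (Fin d) → ℝ}
    {f : Lp ℝ 2 (volume : Measure (EuclideanSpace ℝ (Fin d)))} (h : g =ᵐ[volume] f) :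
    S.T t g =ᵐ[volume] S.U t f := by
  rw [S.T_eq_translateAvg ht]
  exact (translateAvg_congr h).trans (coeFn_avgLp _ f).symm

theorem tendsto_U_zero (f : Lp ℝ 2 (volume : Measure (EuclideanSpace ℝ (Fin d)))) :
    Tendsto (fun t => S.U t f) (𝓝[>] 0) (𝓝 f) :=
  tendsto_avgLp (fun t => S.law t) S.tendsto_law f

theorem U_max_zero (t : ℝ) : S.U (max t 0) = S.U t := by
  rcases le_total t 0 with ht | ht
  · rw [max_eq_right ht, S.U_of_nonpos ht, S.U_of_nonpos le_rfl]
  · rw [max_eq_left ht]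

/-- Contractivity turns right continuity at `0` into continuity everywhere: `‖U_t f - U_s f‖ ≤
‖U_{|t - s|} f - f‖` for `s, t ≥ 0`. The constant extension to negative times gives a function on
all of `ℝ`, convenient for interval integrals. -/
theorem continuous_U (f : Lp ℝ 2 (volume : Measure (EuclideanSpace ℝ (Fin d)))) :
    Continuous fun t => S.U t f := by
  have h0 : Tendsto (fun t => ‖S.U t f - f‖) (𝓝 (0 : ℝ)) (𝓝 0) := by
    have hsup := nhdsLE_sup_nhdsGT (0 : ℝ)
    have hgt := tendsto_iff_norm_sub_tendsto_zero.1 (S.tendsto_U_zero f)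
    suffices hle : Tendsto (fun t => ‖S.U t f - f‖) (𝓝[≤] (0 : ℝ)) (𝓝 0) from
      hsup ▸ hle.sup hgt
    refine tendsto_const_nhds.congr' ?_
    filter_upwards [self_mem_nhdsWithin] with t ht
    simp [S.U_of_nonpos ht]
  have key {s t : ℝ} (hs : 0 ≤ s) (hst : s ≤ t) : ‖S.U t f - S.U s f‖ ≤ ‖S.U (t - s) f - f‖ := by
    have : S.U t f - S.U s f = S.U s (S.U (t - s) f - f) := by
      rw [map_sub, ← mul_apply_eq_comp, ← S.U_add hs (sub_nonneg.2 hst)]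
      simp
    rw [this]
    exact S.norm_U_apply_le s _
  have key2 (s t : ℝ) : ‖S.U t f - S.U s f‖ ≤ ‖S.U |max t 0 - max s 0| f - f‖ := by
    rw [← S.U_max_zero t, ← S.U_max_zero s]
    rcases le_total (max s 0) (max t 0) with h | h
    · rw [abs_of_nonneg (sub_nonneg.2 h)]
      exact key (le_max_right _ _) h
    · rw [abs_of_nonpos (sub_nonpos.2 h), neg_sub, norm_sub_rev]
      exact key (le_max_right _ _) h
  refine continuous_iff_continuousAt.2 fun s => tendsto_iff_norm_sub_tendsto_zero.2 ?_
  refine squeeze_zero (fun _ => norm_nonneg _) (key2 s) (h0.comp ?_)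
  have : Continuous fun t : ℝ => |max t 0 - max s 0| := by fun_prop
  simpa using this.tendsto s

/-! ### The generator on classes, and time averages. -/

/-- `f` is in the domain of the `L²` generator and `v` is the value of the generator at `f`. -/
def HasGen (f v : Lp ℝ 2 (volume : Measure (EuclideanSpace ℝ (Fin d)))) : Prop :=
  Tendsto (fun h : ℝ => h⁻¹ • (S.U h f - f)) (𝓝[>] 0) (𝓝 v)

theorem HasGen.U {S : SymmConvSemigroup d}
    {f v : Lp ℝ 2 (volume : Measure (EuclideanSpace ℝ (Fin d)))} (h : S.HasGen f v) {s : ℝ}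
    (hs : 0 ≤ s) : S.HasGen (S.U s f) (S.U s v) := by
  have h1 := ((S.U s).continuous.tendsto v).comp h
  refine h1.congr' ?_
  filter_upwards [self_mem_nhdsWithin] with t ht
  have ht : 0 ≤ t := le_of_lt ht
  rw [Function.comp_apply, map_smul, map_sub, ← mul_apply_eq_comp, ← S.U_add hs ht,
    add_comm, S.U_add ht hs, mul_apply_eq_comp]

/-- The time average `δ⁻¹ ∫₀^δ T_s f ds`. -/
def timeAvg (δ : ℝ) (f : Lp ℝ 2 (volume : Measure (EuclideanSpace ℝ (Fin d)))) :
    Lp ℝ 2 (volume : Measure (EuclideanSpace ℝ (Fin d))) := δ⁻¹ • ∫ s in (0 : ℝ)..δ, S.U s f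

/-- The integral of the orbit over `[η, η + δ]` minus that over `[0, δ]` equals the one over `[δ, δ
+ η]` minus that over `[0, η]`. Exchanging `δ` and `η` leaves a short integral over `[0, η]`, from
which both the generator and the pointwise Lipschitz bound are read off. -/
theorem U_timeAvg_sub {δ η : ℝ} (hδ : 0 < δ) (hη : 0 ≤ η)
    (f : Lp ℝ 2 (volume : Measure (EuclideanSpace ℝ (Fin d)))) :
    S.U η (S.timeAvg δ f) - S.timeAvg δ f =
      δ⁻¹ • ∫ s in (0 : ℝ)..η, S.U s (S.U δ f - f) := by
  have hc := S.continuous_U f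
  have h1 : S.U η (S.timeAvg δ f) = δ⁻¹ • ∫ s in η..(η + δ), S.U s f := by
    rw [timeAvg, map_smul, ← ContinuousLinearMap.intervalIntegral_comp_comm _
      (hc.intervalIntegrable _ _)]
    have h2 : ∫ s in (0 : ℝ)..δ, S.U η (S.U s f) = ∫ s in (0 : ℝ)..δ, S.U (η + s) f := by
      refine intervalIntegral.integral_congr fun s hs => ?_
      rw [Set.uIcc_of_le hδ.le] at hs
      rw [S.U_add hη hs.1, mul_apply_eq_comp]
    rw [h2, intervalIntegral.integral_comp_add_left (fun s => S.U s f), add_zero]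
  have h3 : ∫ s in (0 : ℝ)..η, S.U s (S.U δ f - f) =
      (∫ s in δ..(δ + η), S.U s f) - ∫ s in (0 : ℝ)..η, S.U s f := by
    have h4 : ∫ s in (0 : ℝ)..η, S.U s (S.U δ f - f) =
        ∫ s in (0 : ℝ)..η, (S.U (δ + s) f - S.U s f) := by
      refine intervalIntegral.integral_congr fun s hs => ?_
      rw [Set.uIcc_of_le hη] at hs
      rw [add_comm, S.U_add hs.1 hδ.le, mul_apply_eq_comp, map_sub]
    rw [h4, intervalIntegral.integral_sub (Continuous.intervalIntegrable
        (u := fun s => S.U (δ + s) f) (hc.comp (continuous_const.add continuous_id)) _ _) (hc.intervalIntegrable _ _),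
      intervalIntegral.integral_comp_add_left (fun s => S.U s f), add_zero]
  rw [h1, h3, timeAvg, ← smul_sub]
  congr 1
  have i := fun a b => hc.intervalIntegrable (μ := volume) a b
  rw [← intervalIntegral.integral_add_adjacent_intervals (i η 0) (i 0 (η + δ)),
    ← intervalIntegral.integral_add_adjacent_intervals (i 0 δ) (i δ (η + δ)),
    intervalIntegral.integral_symm, add_comm δ η]
  abel

theorem tendsto_average {X : Type*} [NormedAddCommGroup X] [NormedSpace ℝ X] [CompleteSpace X]
    {F : ℝ → X} (hF : Continuous F) :
    Tendsto (fun η : ℝ => η⁻¹ • ∫ s in (0 : ℝ)..η, F s) (𝓝[>] 0) (𝓝 (F 0)) := by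
  have h := (intervalIntegral.integral_hasDerivAt_right (hF.intervalIntegrable (μ := volume) 0 0)
    (hF.stronglyMeasurableAtFilter _ _) hF.continuousAt).hasDerivWithinAt (s := Set.Ioi 0)
  rw [hasDerivWithinAt_iff_tendsto_slope' (by simp)] at h
  refine h.congr fun η => ?_
  simp [slope_def_module]

theorem tendsto_timeAvg (f : Lp ℝ 2 (volume : Measure (EuclideanSpace ℝ (Fin d)))) :
    Tendsto (fun δ => S.timeAvg δ f) (𝓝[>] 0) (𝓝 f) := by
  have := tendsto_average (S.continuous_U f)
  rwa [S.U_of_nonpos le_rfl] at this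

theorem hasGen_timeAvg {δ : ℝ} (hδ : 0 < δ)
    (f : Lp ℝ 2 (volume : Measure (EuclideanSpace ℝ (Fin d)))) :
    S.HasGen (S.timeAvg δ f) (δ⁻¹ • (S.U δ f - f)) := by
  have h := (tendsto_average (S.continuous_U (S.U δ f - f))).const_smul δ⁻¹
  rw [S.U_of_nonpos le_rfl] at h
  refine h.congr' ?_
  filter_upwards [self_mem_nhdsWithin] with η hη
  rw [S.U_timeAvg_sub hδ (le_of_lt hη), smul_comm]

/-- A subsequence of an `L²`-convergent sequence converges almost everywhere. -/
theorem isClosed_ae_mem {α : Type*} [MeasurableSpace α] {μ : Measure α} {s : Set ℝ}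
    (hs : IsClosed s) : IsClosed {f : Lp ℝ 2 μ | ∀ᵐ x ∂μ, f x ∈ s} := by
  refine IsSeqClosed.isClosed fun f g hf hg => ?_
  obtain ⟨φ, -, hφ⟩ := (tendstoInMeasure_of_tendsto_Lp hg).exists_seq_tendsto_ae
  filter_upwards [hφ, ae_all_iff.2 hf] with x hx h
  exact hs.mem_of_tendsto hx (Eventually.of_forall fun n => h _)

theorem convex_ae_mem {α : Type*} [MeasurableSpace α] {μ : Measure α} {s : Set ℝ}
    (hs : Convex ℝ s) : Convex ℝ {f : Lp ℝ 2 μ | ∀ᵐ x ∂μ, f x ∈ s} := by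
  intro f hf g hg a b ha hb hab
  have hf : ∀ᵐ x ∂μ, f x ∈ s := hf
  have hg : ∀ᵐ x ∂μ, g x ∈ s := hg
  show ∀ᵐ x ∂μ, (a • f + b • g) x ∈ s
  filter_upwards [hf, hg, Lp.coeFn_add (a • f) (b • g), Lp.coeFn_smul a f, Lp.coeFn_smul b g]
    with x h1 h2 h3 h4 h5
  rw [h3, Pi.add_apply, h4, h5]
  exact hs h1 h2 ha hb hab

/-- Averages over time preserve a.e. membership in a closed convex set. -/
theorem ae_mem_of_average {α : Type*} [MeasurableSpace α] {μ : Measure α} {s : Set ℝ}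
    (hs : Convex ℝ s) (hsc : IsClosed s) {F : ℝ → Lp ℝ 2 μ} (hF : Continuous F) {η : ℝ}
    (hη : 0 < η) (h : ∀ t, 0 ≤ t → ∀ᵐ x ∂μ, F t x ∈ s) :
    ∀ᵐ x ∂μ, (η⁻¹ • ∫ t in (0 : ℝ)..η, F t : Lp ℝ 2 μ) x ∈ s := by
  have h1 := (convex_ae_mem (μ := μ) hs).set_average_mem (isClosed_ae_mem hsc)
    (μ := (volume : Measure ℝ)) (t := Set.Ioc 0 η) (f := F) (by simp [hη]) (by simp) ?_
    ((hF.integrableOn_Icc (a := 0) (b := η)).mono_set Set.Ioc_subset_Icc_self)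
  · rw [setAverage_eq, ← intervalIntegral.integral_of_le hη.le] at h1
    simpa [hη.le] using h1
  · rw [ae_restrict_iff' measurableSet_Ioc]
    exact Eventually.of_forall fun t ht => h t ht.1.le

theorem timeAvg_mem_Icc {δ : ℝ} (hδ : 0 < δ) {a b : ℝ}
    {f : Lp ℝ 2 (volume : Measure (EuclideanSpace ℝ (Fin d)))} (hf : ∀ᵐ x, f x ∈ Set.Icc a b) :
    ∀ᵐ x, S.timeAvg δ f x ∈ Set.Icc a b :=
  ae_mem_of_average (convex_Icc a b) isClosed_Icc (S.continuous_U f) hδ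
    fun _ _ => avgLp_mem_Icc _ hf

/-- `U_δ f - f` takes values in `[-C, C]`, and so do its averages over `[0, η]`; `U_timeAvg_sub`
contributes the factor `η / δ`. The bound is pointwise, which permits dominated convergence against
an `L¹` weight. -/
theorem abs_U_timeAvg_sub_le {δ η C : ℝ} (hδ : 0 < δ) (hη : 0 ≤ η)
    {f : Lp ℝ 2 (volume : Measure (EuclideanSpace ℝ (Fin d)))} (hf : ∀ᵐ x, f x ∈ Set.Icc 0 C) :
    ∀ᵐ x, |S.U η (S.timeAvg δ f) x - S.timeAvg δ f x| ≤ C / δ * η := by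
  rcases hη.eq_or_lt with rfl | hη
  · simp [S.U_of_nonpos le_rfl]
  have h0 : ∀ᵐ x, (S.U δ f - f) x ∈ Set.Icc (-C) C := by
    filter_upwards [hf, avgLp_mem_Icc (S.law δ) hf, Lp.coeFn_sub (S.U δ f) f] with x h1 h2 h3
    rw [h3, Pi.sub_apply, U]
    constructor <;> linarith [h1.1, h1.2, h2.1, h2.2]
  have h1 := ae_mem_of_average (convex_Icc (-C) C) isClosed_Icc (S.continuous_U (S.U δ f - f)) hη
    fun t _ => avgLp_mem_Icc (S.law t) h0
  have h2 : S.U η (S.timeAvg δ f) - S.timeAvg δ f =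
      (η / δ) • (η⁻¹ • ∫ s in (0 : ℝ)..η, S.U s (S.U δ f - f)) := by
    rw [S.U_timeAvg_sub hδ hη.le, smul_smul]
    congr 1
    field_simp
  filter_upwards [h1, Lp.coeFn_sub (S.U η (S.timeAvg δ f)) (S.timeAvg δ f),
    Lp.coeFn_smul (η / δ) (η⁻¹ • ∫ s in (0 : ℝ)..η, S.U s (S.U δ f - f))] with x h3 h4 h5
  rw [h2, h5, Pi.smul_apply, Pi.sub_apply] at h4
  rw [← h4, smul_eq_mul, abs_mul, abs_of_pos (div_pos hη hδ)]
  calc η / δ * _ ≤ η / δ * C := by gcongr; exact abs_le.2 h3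
    _ = C / δ * η := by ring

/-! ### The generator on functions and on classes -/

theorem eLpNorm_quotient_sub {h : ℝ} (hh : 0 < h) {g w : EuclideanSpace ℝ (Fin d) → ℝ}
    {f v : Lp ℝ 2 (volume : Measure (EuclideanSpace ℝ (Fin d)))} (hg : g =ᵐ[volume] f)
    (hw : w =ᵐ[volume] v) :
    eLpNorm (fun x => (S.T h g x - g x) / h - w x) 2 volume = ‖h⁻¹ • (S.U h f - f) - v‖ₑ := by
  rw [Lp.enorm_def]
  refine eLpNorm_congr_ae ?_
  filter_upwards [hg, hw, S.coeFn_U hh hg, Lp.coeFn_sub (h⁻¹ • (S.U h f - f)) v,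
    Lp.coeFn_smul h⁻¹ (S.U h f - f), Lp.coeFn_sub (S.U h f) f] with x h1 h2 h3 h4 h5 h6
  rw [h4, Pi.sub_apply, h5, Pi.smul_apply, h6, Pi.sub_apply, h1, h2, h3, smul_eq_mul,
    div_eq_inv_mul]

theorem hasGenerator_iff {g w : EuclideanSpace ℝ (Fin d) → ℝ}
    {f v : Lp ℝ 2 (volume : Measure (EuclideanSpace ℝ (Fin d)))} (hg : g =ᵐ[volume] f)
    (hw : w =ᵐ[volume] v) : S.HasGenerator g w ↔ S.HasGen f v := by
  have h1 : MemLp g 2 volume := (memLp_congr_ae hg).2 (Lp.memLp f)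
  have h2 : MemLp w 2 volume := (memLp_congr_ae hw).2 (Lp.memLp v)
  simp only [HasGenerator, h1, h2, true_and, HasGen]
  have h3 : (fun h : ℝ => eLpNorm (fun x => (S.T h g x - g x) / h - w x) 2 volume) =ᶠ[𝓝[>] 0]
      fun h => ‖h⁻¹ • (S.U h f - f) - v‖ₑ := by
    filter_upwards [self_mem_nhdsWithin] with h hh
    exact S.eLpNorm_quotient_sub hh hg hw
  rw [tendsto_congr' h3]
  simp_rw [← edist_eq_enorm_sub]
  exact tendsto_iff_edist_tendsto_0.symm

/-- The value picked by choice is determined almost everywhere by uniqueness of `L²` limits. -/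
theorem generator_ae_eq {g : EuclideanSpace ℝ (Fin d) → ℝ}
    {f v : Lp ℝ 2 (volume : Measure (EuclideanSpace ℝ (Fin d)))} (hg : g =ᵐ[volume] f)
    (h : S.HasGen f v) : S.generator g =ᵐ[volume] v := by
  have hex : ∃ w, S.HasGenerator g w := ⟨v, (S.hasGenerator_iff hg EventuallyEq.rfl).2 h⟩
  rw [generator, dif_pos hex]
  have hw := hex.choose_spec
  have hw' := MemLp.coeFn_toLp hw.2.1
  rw [S.hasGenerator_iff hg hw'.symm] at hw
  rw [← tendsto_nhds_unique hw h]
  exact hw'.symm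

theorem exists_hasGen {g : EuclideanSpace ℝ (Fin d) → ℝ} (hg : g ∈ S.domain) :
    ∃ f v : Lp ℝ 2 (volume : Measure (EuclideanSpace ℝ (Fin d))),
      g =ᵐ[volume] f ∧ S.HasGen f v ∧ S.generator g =ᵐ[volume] v := by
  obtain ⟨w, hw⟩ := hg
  have h1 := (MemLp.coeFn_toLp hw.1).symm
  have h2 := (S.hasGenerator_iff h1 (MemLp.coeFn_toLp hw.2.1).symm).1 hw
  exact ⟨_, _, h1, h2, S.generator_ae_eq h1 h2⟩

end SymmConvSemigroup

/-! ### Extended integrals, dominated convergence along `L²` limits, truncation. -/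

section ExtIntegral

variable {α : Type*} [MeasurableSpace α] {μ : Measure α}

theorem extIntegral_congr {f g : α → ℝ} (h : f =ᵐ[μ] g) : extIntegral μ f = extIntegral μ g := by
  rw [extIntegral, extIntegral]
  congr 2
  · exact lintegral_congr_ae (h.mono fun x hx => by simp only [hx])
  · exact lintegral_congr_ae (h.mono fun x hx => by simp only [hx])

theorem extIntegral_of_integrable {f : α → ℝ} (hf : Integrable f μ) :
    extIntegral μ f = ((∫ x, f x ∂μ : ℝ) : EReal) := by
  have h1 : ∫⁻ x, ENNReal.ofReal (f x) ∂μ ≠ ∞ := hf.lintegral_lt_top.ne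
  have h2 : ∫⁻ x, ENNReal.ofReal (-f x) ∂μ ≠ ∞ := hf.neg.lintegral_lt_top.ne
  rw [extIntegral, integral_eq_lintegral_pos_part_sub_lintegral_neg_part hf, EReal.coe_sub,
    EReal.coe_ennreal_toReal h1, EReal.coe_ennreal_toReal h2]

/-- The hypothesis avoids subtraction, so it makes sense for infinite parts too; if the negative
part is infinite, the extended integral is `⊥`. -/
theorem extIntegral_le {f : α → ℝ} {a : ℝ≥0∞}
    (h : ∫⁻ x, ENNReal.ofReal (f x) ∂μ ≤ a + ∫⁻ x, ENNReal.ofReal (-f x) ∂μ) :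
    extIntegral μ f ≤ a := by
  rw [extIntegral]
  refine EReal.sub_le_of_le_add ?_
  exact_mod_cast h

theorem lintegral_pos_le_of_integral_le {f : α → ℝ} (hf : Integrable f μ) {a : ℝ} (ha : 0 ≤ a)
    (h : ∫ x, f x ∂μ ≤ a) :
    ∫⁻ x, ENNReal.ofReal (f x) ∂μ ≤ ENNReal.ofReal a + ∫⁻ x, ENNReal.ofReal (-f x) ∂μ := by
  have h1 : ∫⁻ x, ENNReal.ofReal (f x) ∂μ ≠ ∞ := hf.lintegral_lt_top.ne
  have h2 : ∫⁻ x, ENNReal.ofReal (-f x) ∂μ ≠ ∞ := hf.neg.lintegral_lt_top.ne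
  rw [integral_eq_lintegral_pos_part_sub_lintegral_neg_part hf] at h
  rw [← ENNReal.toReal_le_toReal h1 (by finiteness), ENNReal.toReal_add (by finiteness) h2,
    ENNReal.toReal_ofReal ha]
  linarith

/-- Dominated convergence for continuous functions of `L²`-convergent families. -/
theorem tendsto_integral_comp_Lp {ι : Type*} {l : Filter ι} [l.IsCountablyGenerated]
    {F G : ι → Lp ℝ 2 μ} {f g : Lp ℝ 2 μ} (hF : Tendsto F l (𝓝 f)) (hG : Tendsto G l (𝓝 g))
    {Φ : ℝ × ℝ → ℝ} (hΦ : Measurable Φ) {M : α → ℝ} (hM : Integrable M μ) {C : ℝ}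
    (hb : ∀ᶠ i in l, ∀ᵐ x ∂μ, |Φ (F i x, G i x)| ≤ C)
    (hc : ∀ᵐ x ∂μ, ContinuousAt Φ (f x, g x)) :
    Tendsto (fun i => ∫ x, Φ (F i x, G i x) * M x ∂μ) l (𝓝 (∫ x, Φ (f x, g x) * M x ∂μ)) := by
  -- `L²` convergence gives almost everywhere convergence only along subsequences; two successive
  -- extractions serve `F` and `G`.
  refine tendsto_of_subseq_tendsto fun ns hns => ?_
  obtain ⟨ms, hms, h1⟩ := (tendstoInMeasure_of_tendsto_Lp (hF.comp hns)).exists_seq_tendsto_ae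
  obtain ⟨ks, hks, h2⟩ := (tendstoInMeasure_of_tendsto_Lp
    ((hG.comp hns).comp hms.tendsto_atTop)).exists_seq_tendsto_ae
  refine ⟨ms ∘ ks, ?_⟩
  have hms' : Tendsto (fun n => ns (ms (ks n))) atTop l :=
    hns.comp (hms.tendsto_atTop.comp hks.tendsto_atTop)
  refine tendsto_integral_filter_of_dominated_convergence (fun x => C * |M x|)
    (Eventually.of_forall fun n => ?_) ?_ (hM.abs.const_mul C) ?_
  · exact (hΦ.comp_aemeasurable ((Lp.memLp _).1.aemeasurable.prodMk
      (Lp.memLp _).1.aemeasurable)).aestronglyMeasurable.mul hM.1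
  · filter_upwards [hms'.eventually hb] with n hn
    filter_upwards [hn] with x hx
    rw [norm_mul, Real.norm_eq_abs, Real.norm_eq_abs]
    exact mul_le_mul_of_nonneg_right hx (abs_nonneg _)
  · filter_upwards [h1, h2, hc] with x h3 h4 h5
    refine Tendsto.mul_const _ (h5.tendsto.comp ?_)
    exact ((h3.comp hks.tendsto_atTop).prodMk_nhds h4)

theorem integrable_comp_Lp_mul {f g : Lp ℝ 2 μ} {Φ : ℝ × ℝ → ℝ} (hΦ : Measurable Φ) {M : α → ℝ}
    (hM : Integrable M μ) {C : ℝ} (hb : ∀ᵐ x ∂μ, |Φ (f x, g x)| ≤ C) :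
    Integrable (fun x => Φ (f x, g x) * M x) μ :=
  hM.bdd_mul (hΦ.comp_aemeasurable ((Lp.memLp f).1.aemeasurable.prodMk
    (Lp.memLp g).1.aemeasurable)).aestronglyMeasurable hb

/-- The truncation `min f n` of a function in `L²`. -/
def truncLp (n : ℕ) (f : Lp ℝ 2 μ) : Lp ℝ 2 μ :=
  MemLp.toLp (fun x => min (f x) n) <| (Lp.memLp f).mono
    ((Lp.memLp f).1.inf aestronglyMeasurable_const) <| Eventually.of_forall fun x => by
      rw [Real.norm_eq_abs, Real.norm_eq_abs]
      have hn : (0 : ℝ) ≤ n := n.cast_nonneg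
      rcases le_total (f x) n with h | h
      · rw [min_eq_left h]
      · rw [min_eq_right h, abs_of_nonneg hn, abs_of_nonneg (hn.trans h)]; exact h

theorem coeFn_truncLp (n : ℕ) (f : Lp ℝ 2 μ) : truncLp n f =ᵐ[μ] fun x => min (f x) n :=
  MemLp.coeFn_toLp _

theorem truncLp_mem_Icc (n : ℕ) {f : Lp ℝ 2 μ} (hf : 0 ≤ᵐ[μ] f) :
    ∀ᵐ x ∂μ, truncLp n f x ∈ Set.Icc 0 (n : ℝ) := by
  filter_upwards [coeFn_truncLp n f, hf] with x h1 h2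
  rw [h1]
  exact ⟨le_min h2 n.cast_nonneg, min_le_right _ _⟩

end ExtIntegral

/-! ### Elementary inequalities for the logarithmic ratio. -/

section LogRatio

/-- `log ((a + ε) / (b + ε))`. -/
def logRatio (ε : ℝ) (q : ℝ × ℝ) : ℝ := Real.log ((q.1 + ε) / (q.2 + ε))

theorem measurable_logRatio (ε : ℝ) : Measurable (logRatio ε) := by
  unfold logRatio; fun_prop

theorem continuousAt_logRatio {ε : ℝ} (hε : 0 < ε) {a b : ℝ} (ha : 0 ≤ a) (hb : 0 ≤ b) :
    ContinuousAt (logRatio ε) (a, b) := by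
  have h1 : b + ε ≠ 0 := by positivity
  have h2 : (a + ε) / (b + ε) ≠ 0 := by positivity
  unfold logRatio
  exact ContinuousAt.log (ContinuousAt.div (by fun_prop) (by fun_prop) h1) h2

theorem abs_logRatio_le {ε C : ℝ} (hε : 0 < ε) {a b : ℝ} (ha : a ∈ Set.Icc 0 C)
    (hb : b ∈ Set.Icc 0 C) : |logRatio ε (a, b)| ≤ Real.log ((C + ε) / ε) := by
  have hC : 0 ≤ C := ha.1.trans ha.2
  have ha0 := ha.1
  have hb0 := hb.1
  have h1 := Real.log_le_log (by positivity) (add_le_add_left ha.2 ε)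
  have h2 := Real.log_le_log (by positivity) (add_le_add_left hb.2 ε)
  have h3 := Real.log_le_log hε (le_add_of_nonneg_left ha.1)
  have h4 := Real.log_le_log hε (le_add_of_nonneg_left hb.1)
  rw [logRatio, Real.log_div (by positivity) (by positivity),
    Real.log_div (by positivity) (by positivity), abs_le]
  constructor <;> linarith

/-- This is `log y ≤ y - 1`, with the later value `b` in the denominator; it serves the upper bound.
Its companion `le_logRatio` is `log y ≥ 1 - 1 / y`, with the initial value `a` in the denominator,
and serves the lower bound. -/
theorem logRatio_le {ε : ℝ} (hε : 0 < ε) {a b : ℝ} (ha : 0 ≤ a) (hb : 0 ≤ b) :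
    logRatio ε (a, b) ≤ -(b - a) / (b + ε) := by
  refine (Real.log_le_sub_one_of_pos (by positivity)).trans (le_of_eq ?_)
  have : b + ε ≠ 0 := by positivity
  field_simp
  ring

theorem le_logRatio {ε : ℝ} (hε : 0 < ε) {a b : ℝ} (ha : 0 ≤ a) (hb : 0 ≤ b) :
    (a - b) / (a + ε) ≤ logRatio ε (a, b) := by
  refine le_trans (le_of_eq ?_) (Real.one_sub_inv_le_log_of_pos (by positivity))
  have : a + ε ≠ 0 := by positivity
  have : b + ε ≠ 0 := by positivity
  simp only
  field_simp
  ring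

theorem logRatio_sub {ε : ℝ} (hε : 0 < ε) {a b c : ℝ} (ha : 0 ≤ a) (hb : 0 ≤ b) (hc : 0 ≤ c) :
    logRatio ε (a, c) - logRatio ε (a, b) = logRatio ε (b, c) := by
  simp only [logRatio]
  rw [Real.log_div (by positivity) (by positivity), Real.log_div (by positivity) (by positivity),
    Real.log_div (by positivity) (by positivity)]
  ring

end LogRatio

theorem integral_comp_measurePreserving {α β : Type*} [MeasurableSpace α] [MeasurableSpace β]
    {μ : Measure α} {ν : Measure β} {σ : α → β} (hσ : MeasurePreserving σ μ ν) {g : β → ℝ}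
    (hg : AEStronglyMeasurable g ν) : ∫ x, g (σ x) ∂μ = ∫ y, g y ∂ν := by
  rw [← hσ.map_eq] at hg ⊢
  exact (integral_map hσ.measurable.aemeasurable hg).symm

/-- The difference of the two sides is the square `(p B - q A)² / (A B)`. This is the two-point form
of the Donsker–Varadhan inequality. -/
theorem sq_mul_sub_div_add_le {A B p q : ℝ} (hA : 0 < A) (hB : 0 < B) :
    (A - B) / A * p ^ 2 + (B - A) / B * q ^ 2 ≤ (p - q) ^ 2 := by
  have h : (p - q) ^ 2 - ((A - B) / A * p ^ 2 + (B - A) / B * q ^ 2) =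
      (p * B - q * A) ^ 2 / (A * B) := by
    field_simp
    ring
  have : 0 ≤ (p * B - q * A) ^ 2 / (A * B) := by positivity
  linarith

/-! ### The upper bound: a differential inequality along orbits. -/

namespace SymmConvSemigroup

variable {d : ℕ} {S : SymmConvSemigroup d} {M : EuclideanSpace ℝ (Fin d) → ℝ}

local notation "L2" => Lp ℝ 2 (volume : Measure (EuclideanSpace ℝ (Fin d)))

theorem extIntegral_le_rateFunctional {f v : L2} (h : S.HasGen f v) {C : ℝ}
    (hf : ∀ᵐ x, f x ∈ Set.Icc 0 C) {ε : ℝ} (hε : 0 < ε) :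
    extIntegral volume (fun x => -v x / (f x + ε) * M x) ≤ S.rateFunctional M := by
  -- Clamping a measurable representative makes the almost everywhere bounds hold everywhere, as
  -- test functions require.
  set u : EuclideanSpace ℝ (Fin d) → ℝ := fun x => max 0 (min (f x) C) with hu
  have huf : u =ᵐ[volume] f := by
    filter_upwards [hf] with x hx
    rw [hu]
    simp only
    rw [min_eq_left hx.2, max_eq_right hx.1]
  have hmem : u ∈ S.testFunctions := by
    refine ⟨?_, fun x => le_max_left _ _, ⟨max 0 C, fun x => max_le_max le_rfl (min_le_right _ _)⟩,
      v, (S.hasGenerator_iff huf EventuallyEq.rfl).2 h⟩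
    exact measurable_const.max ((Lp.stronglyMeasurable f).measurable.min measurable_const)
  have h1 : extIntegral volume (fun x => -v x / (f x + ε) * M x) =
      extIntegral volume (fun x => -S.generator u x / (u x + ε) * M x) := by
    refine extIntegral_congr ?_
    filter_upwards [huf, S.generator_ae_eq huf h] with x h2 h3
    rw [h2, h3]
  rw [h1, rateFunctional]
  exact le_iSup₂_of_le u hmem (le_iSup₂_of_le ε hε le_rfl)

theorem rateFunctional_nonneg : 0 ≤ S.rateFunctional M := by
  have h0 : S.HasGen 0 0 := by
    unfold HasGen
    simp
  have h := extIntegral_le_rateFunctional (M := M) (C := 0) h0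
    (Eventually.of_forall fun x => by simp) one_pos
  refine le_trans (le_of_eq ?_) h
  rw [extIntegral_congr (g := fun _ => 0) (Eventually.of_forall fun x => by simp)]
  simp [extIntegral]

/-- Right derivative at time `0`: `logRatio_le` bounds the integrand by a difference quotient over
`U_η u + ε`. The Lipschitz hypothesis dominates this by `K / ε`, so its `M`-integral converges to
one of those in the rate functional. -/
theorem HasGen.integral_logRatio_le (hM : Integrable M) (hM0 : ∀ x, 0 ≤ M x)
    {u v : L2} (h : S.HasGen u v) {C : ℝ} (hu : ∀ᵐ x, u x ∈ Set.Icc 0 C) {K : ℝ}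
    (hK : ∀ η, 0 ≤ η → ∀ᵐ x, |S.U η u x - u x| ≤ K * η) {I : ℝ} (hI : S.rateFunctional M ≤ I)
    {ε : ℝ} (hε : 0 < ε) {r : ℝ} (hr : I < r) :
    ∀ᶠ η in 𝓝[>] (0 : ℝ), η⁻¹ * ∫ x, logRatio ε (u x, S.U η u x) * M x < r := by
  have hUmem (η : ℝ) : ∀ᵐ x, S.U η u x ∈ Set.Icc 0 C := avgLp_mem_Icc _ hu
  have hDcoe (η : ℝ) : ∀ᵐ x, (η⁻¹ • (S.U η u - u) : L2) x = η⁻¹ * (S.U η u x - u x) := by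
    filter_upwards [Lp.coeFn_smul η⁻¹ (S.U η u - u), Lp.coeFn_sub (S.U η u) u] with x h1 h2
    rw [h1, Pi.smul_apply, h2, Pi.sub_apply, smul_eq_mul]
  have hΦ : Measurable fun q : ℝ × ℝ => -q.1 / (q.2 + ε) := by fun_prop
  have hbound : ∀ η, 0 < η → ∀ᵐ x, |-(η⁻¹ • (S.U η u - u) : L2) x / (S.U η u x + ε)| ≤ K / ε := by
    intro η hη
    filter_upwards [hDcoe η, hUmem η, hK η hη.le] with x h1 h2 h3
    have h2' := h2.1
    have hK0 : 0 ≤ K := by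
      by_contra hneg
      exact absurd ((abs_nonneg _).trans h3) (not_le.2 (mul_neg_of_neg_of_pos (not_le.1 hneg) hη))
    rw [h1, abs_div, abs_neg, abs_mul, abs_of_pos (inv_pos.2 hη),
      abs_of_pos (a := _ + ε) (by positivity)]
    gcongr
    · rw [inv_mul_le_iff₀ hη, mul_comm]; exact h3
    · linarith
  have hlim := tendsto_integral_comp_Lp (l := 𝓝[>] (0 : ℝ)) h (S.tendsto_U_zero u) hΦ hM
    (C := K / ε) (by filter_upwards [self_mem_nhdsWithin] with η hη; exact hbound η hη)
    (by
      filter_upwards [hu] with x hx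
      have : u x + ε ≠ 0 := by linarith [hx.1]
      exact ContinuousAt.div (by fun_prop) (by fun_prop) this)
  have hle : ∫ x, -v x / (u x + ε) * M x ≤ I := by
    -- The limit `v` inherits the bound `K`, so the extended integral in the rate functional is an
    -- ordinary one.
    have hvb : ∀ᵐ x, v x ∈ Set.Icc (-K) K := by
      refine (isClosed_ae_mem (μ := volume) isClosed_Icc).mem_of_tendsto h ?_
      filter_upwards [self_mem_nhdsWithin] with η hη
      have hη : 0 < η := hη
      filter_upwards [hDcoe η, hK η hη.le] with x h1 h3
      rw [h1]
      refine abs_le.1 ?_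
      rw [abs_mul, abs_of_pos (inv_pos.2 hη), inv_mul_le_iff₀ hη, mul_comm]
      exact h3
    have hint : Integrable (fun x => -v x / (u x + ε) * M x) :=
      integrable_comp_Lp_mul hΦ hM (C := K / ε) <| by
        filter_upwards [hvb, hu] with x h1 h2
        have h2' := h2.1
        have h1' := abs_le.2 h1
        have hK0 : 0 ≤ K := (abs_nonneg _).trans h1'
        rw [abs_div, abs_neg, abs_of_pos (a := _ + ε) (by positivity)]
        gcongr
        linarith
    have := (extIntegral_le_rateFunctional (M := M) h hu hε).trans hI
    rw [extIntegral_of_integrable hint] at this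
    exact_mod_cast this
  filter_upwards [hlim.eventually_lt_const (hle.trans_lt hr), self_mem_nhdsWithin] with η h1 hη
  have hη : 0 < η := hη
  refine lt_of_le_of_lt ?_ h1
  rw [← integral_const_mul]
  refine integral_mono_ae ?_ (integrable_comp_Lp_mul hΦ hM (hbound η hη)) ?_
  · refine (integrable_comp_Lp_mul (measurable_logRatio ε) hM
      (C := Real.log ((C + ε) / ε)) ?_).const_mul _
    filter_upwards [hu, hUmem η] with x h2 h3
    exact abs_logRatio_le hε h2 h3
  · filter_upwards [hDcoe η, hu, hUmem η] with x h2 h3 h4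
    rw [h2, ← mul_assoc]
    refine mul_le_mul_of_nonneg_right ?_ (hM0 x)
    calc η⁻¹ * logRatio ε (u x, S.U η u x) ≤ η⁻¹ * (-(S.U η u x - u x) / (S.U η u x + ε)) := by
          have := logRatio_le hε h3.1 h4.1
          gcongr
      _ = _ := by ring

theorem integrable_logRatio_mul (hM : Integrable M) {f g : L2} {C : ℝ}
    (hf : ∀ᵐ x, f x ∈ Set.Icc 0 C) (hg : ∀ᵐ x, g x ∈ Set.Icc 0 C) {ε : ℝ} (hε : 0 < ε) :
    Integrable (fun x => logRatio ε (f x, g x) * M x) :=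
  integrable_comp_Lp_mul (measurable_logRatio ε) hM (C := Real.log ((C + ε) / ε)) <| by
    filter_upwards [hf, hg] with x h2 h3
    exact abs_logRatio_le hε h2 h3

theorem tendsto_integral_logRatio {ι : Type*} {l : Filter ι} [l.IsCountablyGenerated]
    (hM : Integrable M) {F G : ι → L2} {f g : L2} (hF : Tendsto F l (𝓝 f))
    (hG : Tendsto G l (𝓝 g)) {C : ℝ} (hFC : ∀ᶠ i in l, ∀ᵐ x, F i x ∈ Set.Icc 0 C)
    (hGC : ∀ᶠ i in l, ∀ᵐ x, G i x ∈ Set.Icc 0 C) (hf : ∀ᵐ x, f x ∈ Set.Icc 0 C)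
    (hg : ∀ᵐ x, g x ∈ Set.Icc 0 C) {ε : ℝ} (hε : 0 < ε) :
    Tendsto (fun i => ∫ x, logRatio ε (F i x, G i x) * M x) l
      (𝓝 (∫ x, logRatio ε (f x, g x) * M x)) := by
  refine tendsto_integral_comp_Lp hF hG (measurable_logRatio ε) hM (C := Real.log ((C + ε) / ε))
    ?_ ?_
  · filter_upwards [hFC, hGC] with i h1 h2
    filter_upwards [h1, h2] with x h3 h4
    exact abs_logRatio_le hε h3 h4
  · filter_upwards [hf, hg] with x h3 h4
    exact continuousAt_logRatio hε h3.1 h4.1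

/-- By `logRatio_sub` and the semigroup law, the slope at time `s` is the slope at time `0` for the
orbit restarted from `U_s u`. Hence every right derivative is controlled by `I`, and a comparison
theorem integrates the bound. -/
theorem integral_logRatio_le_of_lipschitz (hM : Integrable M) (hM0 : ∀ x, 0 ≤ M x)
    {u v : L2} (h : S.HasGen u v) {C : ℝ} (hu : ∀ᵐ x, u x ∈ Set.Icc 0 C) {K : ℝ}
    (hK : ∀ η, 0 ≤ η → ∀ᵐ x, |S.U η u x - u x| ≤ K * η) {I : ℝ} (hI : S.rateFunctional M ≤ I)
    {ε : ℝ} (hε : 0 < ε) {t : ℝ} (ht : 0 ≤ t) :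
    ∫ x, logRatio ε (u x, S.U t u x) * M x ≤ I * t := by
  have hUmem (s : ℝ) : ∀ᵐ x, S.U s u x ∈ Set.Icc 0 C := avgLp_mem_Icc _ hu
  have hcont : Continuous fun s => ∫ x, logRatio ε (u x, S.U s u x) * M x :=
    continuous_iff_continuousAt.2 fun s => tendsto_integral_logRatio hM tendsto_const_nhds
      ((S.continuous_U u).tendsto s) (Eventually.of_forall fun _ => hu)
      (Eventually.of_forall hUmem) hu (hUmem s) hε
  refine image_le_of_liminf_slope_right_le_deriv_boundary (a := 0) (b := t)
    (f := fun s => ∫ x, logRatio ε (u x, S.U s u x) * M x) (B := fun s => I * s) (B' := fun _ => I)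
    hcont.continuousOn ?_ (by fun_prop) ?_ ?_ ⟨ht, le_rfl⟩
  · have h0 : ∫ x, logRatio ε (u x, S.U 0 u x) * M x = 0 := by
      rw [S.U_of_nonpos le_rfl]
      refine integral_eq_zero_of_ae ?_
      filter_upwards [hu] with x hx
      have : u x + ε ≠ 0 := by linarith [hx.1]
      simp [logRatio, div_self this]
    rw [h0, mul_zero]
  · intro s _
    simpa using ((hasDerivAt_id s).const_mul I).hasDerivWithinAt
  · intro s hs r hr
    have hs0 : 0 ≤ s := hs.1
    -- `U_s` commutes with `U_η` and preserves pointwise bounds, so the restarted orbit keeps the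
    -- constant `K`.
    have hKs : ∀ η, 0 ≤ η → ∀ᵐ x, |S.U η (S.U s u) x - S.U s u x| ≤ K * η := by
      intro η hη
      have h1 : ∀ᵐ x, (S.U η u - u) x ∈ Set.Icc (-(K * η)) (K * η) := by
        filter_upwards [hK η hη, Lp.coeFn_sub (S.U η u) u] with x h2 h3
        rw [h3]
        exact abs_le.1 h2
      have h2 : S.U η (S.U s u) - S.U s u = S.U s (S.U η u - u) := by
        rw [map_sub, ← mul_apply_eq_comp, ← mul_apply_eq_comp, ← S.U_add hs0 hη,
          ← S.U_add hη hs0, add_comm]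
      filter_upwards [avgLp_mem_Icc (S.law s) h1, Lp.coeFn_sub (S.U η (S.U s u)) (S.U s u)]
        with x h3 h4
      rw [h2, Pi.sub_apply] at h4
      rw [← h4]
      exact abs_le.2 h3
    have hev := (h.U hs0).integral_logRatio_le hM hM0 (hUmem s) hKs hI hε hr
    have htr : Tendsto (fun z => z - s) (𝓝[>] s) (𝓝[>] 0) := by
      refine tendsto_nhdsWithin_iff.2 ⟨?_, ?_⟩
      · refine Tendsto.mono_left ?_ nhdsWithin_le_nhds
        have : Continuous fun z : ℝ => z - s := by fun_prop
        simpa using this.tendsto s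
      · filter_upwards [self_mem_nhdsWithin] with z hz
        exact sub_pos.2 (Set.mem_Ioi.1 hz)
    refine Eventually.frequently ?_
    filter_upwards [htr.eventually hev, self_mem_nhdsWithin] with z h1 hz
    have hz : s < z := hz
    rw [slope_def_field, div_eq_inv_mul]
    refine lt_of_le_of_lt (le_of_eq ?_) h1
    rw [← integral_sub (integrable_logRatio_mul hM hu (hUmem z) hε)
      (integrable_logRatio_mul hM hu (hUmem s) hε)]
    congr 1
    refine integral_congr_ae ?_
    have h2 : S.U (z - s) (S.U s u) = S.U z u := by
      rw [← mul_apply_eq_comp, ← S.U_add (sub_pos.2 hz).le hs0, sub_add_cancel]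
    filter_upwards [hu, hUmem s, hUmem z] with x h3 h4 h5
    rw [h2, ← sub_mul, logRatio_sub hε h3.1 h4.1 h5.1]

theorem integral_logRatio_le_of_bounded (hM : Integrable M) (hM0 : ∀ x, 0 ≤ M x)
    {f : L2} {C : ℝ} (hf : ∀ᵐ x, f x ∈ Set.Icc 0 C) {I : ℝ} (hI : S.rateFunctional M ≤ I)
    {ε : ℝ} (hε : 0 < ε) {t : ℝ} (ht : 0 ≤ t) :
    ∫ x, logRatio ε (f x, S.U t f x) * M x ≤ I * t := by
  have hA : ∀ᶠ δ in 𝓝[>] (0 : ℝ), ∀ᵐ x, S.timeAvg δ f x ∈ Set.Icc 0 C := by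
    filter_upwards [self_mem_nhdsWithin] with δ hδ using S.timeAvg_mem_Icc hδ hf
  refine le_of_tendsto (tendsto_integral_logRatio hM (S.tendsto_timeAvg f)
    (((S.U t).continuous.tendsto f).comp (S.tendsto_timeAvg f)) hA
    (hA.mono fun δ h => avgLp_mem_Icc _ h) hf (avgLp_mem_Icc _ hf) hε) ?_
  filter_upwards [self_mem_nhdsWithin] with δ hδ
  exact integral_logRatio_le_of_lipschitz hM hM0 (S.hasGen_timeAvg hδ f) (S.timeAvg_mem_Icc hδ hf)
    (fun η hη => S.abs_U_timeAvg_sub_le hδ hη hf) hI hε ht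

theorem extIntegral_logRatio_le (hM : Integrable M) (hM0 : ∀ x, 0 ≤ M x)
    {f : L2} (hf : 0 ≤ᵐ[volume] f) {I : ℝ} (hI : S.rateFunctional M ≤ I)
    {ε : ℝ} (hε : 0 < ε) {t : ℝ} (ht : 0 ≤ t) :
    extIntegral volume (fun x => logRatio ε (f x, S.U t f x) * M x) ≤ (I * t : ℝ) := by
  have hI0 : 0 ≤ I := by exact_mod_cast (rateFunctional_nonneg (S := S) (M := M)).trans hI
  have hIt : 0 ≤ I * t := mul_nonneg hI0 ht
  have hUf : 0 ≤ᵐ[volume] S.U t f := avgLp_nonneg _ hf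
  set F := fun x => logRatio ε (f x, S.U t f x) * M x with hF
  have hFm : AEMeasurable F := ((measurable_logRatio ε).comp_aemeasurable
    ((Lp.memLp _).1.aemeasurable.prodMk (Lp.memLp _).1.aemeasurable)).mul hM.1.aemeasurable
  have hsm := (Lp.stronglyMeasurable f).measurable
  set A : ℕ → Set (EuclideanSpace ℝ (Fin d)) := fun n => {x | f x ≤ n} with hA
  have hAm (n : ℕ) : MeasurableSet (A n) := measurableSet_le hsm measurable_const
  have hmain (n : ℕ) : ∫⁻ x, (A n).indicator (fun x => ENNReal.ofReal (F x)) x ≤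
      ENNReal.ofReal (I * t) + ∫⁻ x, ENNReal.ofReal (-F x) := by
    -- hmain (n) compares with the bounded case. Where `f ≤ n`, truncation keeps the numerator and
    -- can only lower the denominator, so the logarithm increases. Where `f > n`, the numerator is
    -- `n + ε` and `U_t fn ≤ n`, so the truncated logarithm is non-negative.
    set fn := truncLp n f with hfn
    have hmem := truncLp_mem_Icc n hf
    have hUmem : ∀ᵐ x, S.U t fn x ∈ Set.Icc 0 (n : ℝ) := avgLp_mem_Icc _ hmem
    have hle : fn ≤ᵐ[volume] f := by
      filter_upwards [coeFn_truncLp n f] with x hx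
      rw [hfn, hx]
      exact min_le_left _ _
    have hUle : S.U t fn ≤ᵐ[volume] S.U t f := avgLp_mono _ hle
    have hpt : ∀ᵐ x, (f x ≤ n → F x ≤ logRatio ε (fn x, S.U t fn x) * M x) ∧
        (¬ f x ≤ n → 0 ≤ logRatio ε (fn x, S.U t fn x) * M x) := by
      filter_upwards [hmem, hUmem, hUle, coeFn_truncLp n f, hf] with x h1 h2 h3 h4 h5
      have h5 : 0 ≤ f x := h5
      have h2' := h2.1
      rw [hfn, h4]
      constructor
      · intro h6
        rw [min_eq_left h6]
        refine mul_le_mul_of_nonneg_right ?_ (hM0 x)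
        have : 0 ≤ S.U t f x := h2'.trans h3
        refine Real.log_le_log (by positivity) ?_
        dsimp only
        gcongr
      · intro h6
        rw [min_eq_right (not_le.1 h6).le]
        refine mul_nonneg (Real.log_nonneg ?_) (hM0 x)
        rw [one_le_div (by positivity)]
        exact add_le_add_left h2.2 ε
    have hint := integrable_logRatio_mul hM hmem hUmem hε
    calc ∫⁻ x, (A n).indicator (fun x => ENNReal.ofReal (F x)) x
        ≤ ∫⁻ x, ENNReal.ofReal (logRatio ε (fn x, S.U t fn x) * M x) := by
          refine lintegral_mono_ae ?_
          filter_upwards [hpt] with x hx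
          refine Set.indicator_apply_le' (fun h => ?_) (fun _ => zero_le)
          exact ENNReal.ofReal_le_ofReal (hx.1 h)
      _ ≤ ENNReal.ofReal (I * t) + ∫⁻ x, ENNReal.ofReal (-(logRatio ε (fn x, S.U t fn x) * M x)) :=
          lintegral_pos_le_of_integral_le hint hIt
            (integral_logRatio_le_of_bounded hM hM0 hmem hI hε ht)
      _ ≤ _ := by
          gcongr 1
          refine lintegral_mono_ae ?_
          filter_upwards [hpt] with x hx
          by_cases h : f x ≤ n
          · exact ENNReal.ofReal_le_ofReal (neg_le_neg (hx.1 h))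
          · rw [ENNReal.ofReal_of_nonpos (neg_nonpos.2 (hx.2 h))]
            exact zero_le
  have hlim : Tendsto (fun n => ∫⁻ x, (A n).indicator (fun x => ENNReal.ofReal (F x)) x) atTop
      (𝓝 (∫⁻ x, ENNReal.ofReal (F x))) := by
    refine lintegral_tendsto_of_tendsto_of_monotone
      (fun n => hFm.ennreal_ofReal.indicator (hAm n)) (Eventually.of_forall fun x => ?_)
      (Eventually.of_forall fun x => ?_)
    · intro m n hmn
      refine Set.indicator_le_indicator_of_subset (fun y (hy : f y ≤ m) => ?_) (fun _ => zero_le) x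
      exact hy.trans (by exact_mod_cast hmn)
    · obtain ⟨N, hN⟩ := exists_nat_ge (f x)
      refine tendsto_const_nhds.congr' ?_
      filter_upwards [eventually_ge_atTop N] with n hn
      rw [Set.indicator_of_mem]
      exact hN.trans (by exact_mod_cast hn)
  have h := extIntegral_le (le_of_tendsto' hlim hmain)
  rwa [EReal.coe_ennreal_ofReal, max_eq_left hIt] at h

/-- The supremum of `φ(t, g, ε)` over `g` and `ε`. -/
def supPhi (S : SymmConvSemigroup d) (M : EuclideanSpace ℝ (Fin d) → ℝ) (t : ℝ) : EReal :=
  ⨆ g ∈ S.domainNonneg, ⨆ ε ∈ Set.Ioi (0 : ℝ), S.phi M t g ε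

theorem phi_eq {t : ℝ} (ht : 0 < t) {g : EuclideanSpace ℝ (Fin d) → ℝ} {f : L2}
    (h : g =ᵐ[volume] f) (ε : ℝ) :
    S.phi M t g ε = extIntegral volume (fun x => logRatio ε (f x, S.U t f x) * M x) := by
  refine extIntegral_congr ?_
  filter_upwards [h, S.coeFn_U ht h] with x h1 h2
  rw [h1, h2]; rfl

theorem supPhi_le (hM : Integrable M) (hM0 : ∀ x, 0 ≤ M x) {I : ℝ}
    (hI : S.rateFunctional M ≤ I) {t : ℝ} (ht : 0 < t) : S.supPhi M t ≤ (I * t : ℝ) := by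
  refine iSup₂_le fun g hg => iSup₂_le fun ε hε => ?_
  obtain ⟨f, v, hgf, -, -⟩ := S.exists_hasGen hg.1
  rw [phi_eq ht hgf]
  exact extIntegral_logRatio_le hM hM0 (hg.2.trans_eq hgf) hI hε ht.le

/-- `f` need not lie in the domain: its time averages do, and the integrals converge. This admits
truncations of `√M` as competitors. -/
theorem le_supPhi_of_bounded (hM : Integrable M) {f : L2} {C : ℝ}
    (hf : ∀ᵐ x, f x ∈ Set.Icc 0 C) {ε : ℝ} (hε : 0 < ε) {t : ℝ} (ht : 0 < t) :
    ((∫ x, logRatio ε (f x, S.U t f x) * M x : ℝ) : EReal) ≤ S.supPhi M t := by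
  have hA : ∀ᶠ δ in 𝓝[>] (0 : ℝ), ∀ᵐ x, S.timeAvg δ f x ∈ Set.Icc 0 C := by
    filter_upwards [self_mem_nhdsWithin] with δ hδ using S.timeAvg_mem_Icc hδ hf
  refine le_of_tendsto (EReal.tendsto_coe.2 (tendsto_integral_logRatio hM (S.tendsto_timeAvg f)
    (((S.U t).continuous.tendsto f).comp (S.tendsto_timeAvg f)) hA
    (hA.mono fun δ h => avgLp_mem_Icc _ h) hf (avgLp_mem_Icc _ hf) hε)) ?_
  filter_upwards [self_mem_nhdsWithin, hA] with δ hδ hmem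
  rw [Function.comp_apply, ← extIntegral_of_integrable
    (integrable_logRatio_mul (g := S.U t _) hM hmem (avgLp_mem_Icc _ hmem) hε)]
  refine le_trans (le_of_eq (phi_eq ht EventuallyEq.rfl ε).symm) ?_
  refine le_iSup₂_of_le (S.timeAvg δ f : EuclideanSpace ℝ (Fin d) → ℝ)
    ⟨⟨(δ⁻¹ • (S.U δ f - f) : L2), ?_⟩, hmem.mono fun x hx => hx.1⟩ (le_iSup₂_of_le ε hε le_rfl)
  exact (S.hasGenerator_iff EventuallyEq.rfl EventuallyEq.rfl).2 (S.hasGen_timeAvg hδ f)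

/-! ### The lower bound: the approximate Dirichlet form of `√M`. -/

/-- The approximate Dirichlet form `∬ (f x - f (x + z))² p_t(z) dz dx`. -/
def dirichlet (S : SymmConvSemigroup d) (t : ℝ) (f : L2) : ℝ :=
  ∫ q, (f q.1 - f (q.1 + q.2)) ^ 2
    ∂((volume : Measure (EuclideanSpace ℝ (Fin d))).prod (S.law t))

theorem memLp_comp_fst (t : ℝ) (f : L2) :
    MemLp (fun q : EuclideanSpace ℝ (Fin d) × EuclideanSpace ℝ (Fin d) => f q.1) 2
      ((volume : Measure (EuclideanSpace ℝ (Fin d))).prod (S.law t)) :=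
  (Lp.memLp f).comp_measurePreserving measurePreserving_fst

theorem integral_fst_mul_add {t : ℝ} {f : L2} {g : EuclideanSpace ℝ (Fin d) → ℝ}
    (h : Integrable (fun q : EuclideanSpace ℝ (Fin d) × EuclideanSpace ℝ (Fin d) =>
      g q.1 * f (q.1 + q.2)) ((volume : Measure (EuclideanSpace ℝ (Fin d))).prod (S.law t))) :
    ∫ q, g q.1 * f (q.1 + q.2) ∂((volume : Measure (EuclideanSpace ℝ (Fin d))).prod (S.law t)) =
      ∫ x, g x * S.U t f x := by
  rw [integral_prod _ h]
  refine integral_congr_ae ?_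
  filter_upwards [coeFn_avgLp (S.law t) f] with x hx
  rw [U, hx, translateAvg, integral_const_mul]

theorem integrable_dirichlet (t : ℝ) (f : L2) :
    Integrable (fun q : EuclideanSpace ℝ (Fin d) × EuclideanSpace ℝ (Fin d) =>
      (f q.1 - f (q.1 + q.2)) ^ 2)
      ((volume : Measure (EuclideanSpace ℝ (Fin d))).prod (S.law t)) :=
  ((memLp_comp_fst t f).sub (memLp_comp_add (S.law t) (Lp.memLp f))).integrable_sq

/-- Expand the square; `q.1` and `q.1 + q.2` both push `dx ⊗ P` to Lebesgue measure. -/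
theorem dirichlet_eq (t : ℝ) (f : L2) :
    S.dirichlet t f = 2 * ((∫ x, f x ^ 2) - ∫ x, f x * S.U t f x) := by
  have h1 := memLp_comp_fst (S := S) t f
  have h2 := memLp_comp_add (S.law t) (Lp.memLp f)
  have h3 : Integrable (fun q : EuclideanSpace ℝ (Fin d) × EuclideanSpace ℝ (Fin d) =>
      f q.1 * f (q.1 + q.2)) ((volume : Measure (EuclideanSpace ℝ (Fin d))).prod (S.law t)) :=
    h1.integrable_mul h2
  have h4 : Integrable (fun q : EuclideanSpace ℝ (Fin d) × EuclideanSpace ℝ (Fin d) =>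
      f q.1 ^ 2 + f (q.1 + q.2) ^ 2)
      ((volume : Measure (EuclideanSpace ℝ (Fin d))).prod (S.law t)) :=
    h1.integrable_sq.add h2.integrable_sq
  have hm : AEStronglyMeasurable (fun x => f x ^ 2)
      (volume : Measure (EuclideanSpace ℝ (Fin d))) := (Lp.memLp f).1.pow 2
  have e1 := integral_comp_measurePreserving (measurePreserving_fst
    (μ := (volume : Measure (EuclideanSpace ℝ (Fin d)))) (ν := S.law t)) hm
  have e2 := integral_comp_measurePreserving (measurePreserving_add_prod_right (S.law t)) hm
  have e3 := integral_fst_mul_add (S := S) (t := t) (g := f) h3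
  have e4 : S.dirichlet t f = ∫ q, (f q.1 ^ 2 + f (q.1 + q.2) ^ 2 - 2 * (f q.1 * f (q.1 + q.2)))
      ∂((volume : Measure (EuclideanSpace ℝ (Fin d))).prod (S.law t)) :=
    integral_congr_ae (Eventually.of_forall fun q => by ring)
  rw [e4, integral_sub h4 (h3.const_mul 2),
    integral_add h1.integrable_sq h2.integrable_sq, integral_const_mul, e1, e2, e3]
  ring

/-- The map `x ↦ min x n` is `1`-Lipschitz. -/
theorem dirichlet_truncLp_le (t : ℝ) (n : ℕ) (f : L2) :
    S.dirichlet t (truncLp n f) ≤ S.dirichlet t f := by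
  refine integral_mono_ae (integrable_dirichlet t _) (integrable_dirichlet t f) ?_
  filter_upwards [(measurePreserving_fst (μ := (volume : Measure (EuclideanSpace ℝ (Fin d))))
      (ν := S.law t)).quasiMeasurePreserving.ae (coeFn_truncLp n f),
    (measurePreserving_add_prod_right (S.law t)).quasiMeasurePreserving.ae (coeFn_truncLp n f)]
    with q h1 h2
  rw [h1, h2]
  refine sq_le_sq.2 ((abs_min_sub_min_le_max _ _ _ _).trans ?_)
  simp

/-- The Donsker–Varadhan inequality for `T_t`: `∫ (f - T_t f) / (f + ε) ψ²` is at most half the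
approximate Dirichlet form of `ψ`. -/
theorem two_mul_integral_le_dirichlet {t : ℝ} {f ψ : L2} {C : ℝ} (hf : ∀ᵐ x, f x ∈ Set.Icc 0 C)
    {ε : ℝ} (hε : 0 < ε) :
    2 * ∫ x, (f x - S.U t f x) / (f x + ε) * ψ x ^ 2 ≤ S.dirichlet t ψ := by
  set ν := (volume : Measure (EuclideanSpace ℝ (Fin d))).prod (S.law t) with hν
  set a : EuclideanSpace ℝ (Fin d) × EuclideanSpace ℝ (Fin d) → ℝ :=
    fun q => (f q.1 - f (q.1 + q.2)) / (f q.1 + ε) * ψ q.1 ^ 2 with ha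
  have hfst := (measurePreserving_fst (μ := (volume : Measure (EuclideanSpace ℝ (Fin d))))
      (ν := S.law t)).quasiMeasurePreserving.ae hf
  have hadd := (measurePreserving_add_prod_right (S.law t)).quasiMeasurePreserving.ae hf
  have hfm := (memLp_comp_fst (S := S) t f).1.aemeasurable
  have hfm' := (memLp_comp_add (S.law t) (Lp.memLp f)).1.aemeasurable
  have hψ := (memLp_comp_fst (S := S) t ψ)
  have hbd : ∀ᵐ q ∂ν, |(f q.1 - f (q.1 + q.2)) / (f q.1 + ε)| ≤ C / ε := by
    filter_upwards [hfst, hadd] with q h1 h2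
    have h1' := h1.1
    have hC := h1.1.trans h1.2
    rw [abs_div, abs_of_pos (a := _ + ε) (by positivity)]
    gcongr
    · exact abs_le.2 ⟨by linarith [h1.1, h2.2], by linarith [h1.2, h2.1]⟩
    · linarith
  have haint : Integrable a ν := hψ.integrable_sq.bdd_mul
    ((hfm.sub hfm').div (hfm.add_const ε)).aestronglyMeasurable hbd
  have hflip := measurePreserving_flip (S.law t) (S.map_neg_law t)
  have hI : ∫ q, a q ∂ν = ∫ x, (f x - S.U t f x) / (f x + ε) * ψ x ^ 2 := by
    rw [integral_prod _ haint]
    refine integral_congr_ae ?_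
    filter_upwards [coeFn_avgLp (S.law t) f, ae_integrable_translate (S.law t) (Lp.memLp f)]
      with x h1 h2
    have e : ∀ z, a (x, z) = (f x - f (x + z)) * ((f x + ε)⁻¹ * ψ x ^ 2) := fun z => by
      simp only [ha]; ring
    simp_rw [e]
    rw [integral_mul_const, integral_sub (integrable_const _) h2, U, h1, translateAvg]
    simp only [integral_const, probReal_univ, one_smul]
    ring
  -- The flip exchanges the two endpoints of a jump. Adding `a` to its flip gives the symmetric
  -- two-point expression of `sq_mul_sub_div_add_le`.
  have hI2 : ∫ q, a (q.1 + q.2, -q.2) ∂ν = ∫ q, a q ∂ν :=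
    integral_comp_measurePreserving hflip haint.1
  rw [← hI, two_mul]
  nth_rewrite 2 [← hI2]
  have haint2 : Integrable (fun q : EuclideanSpace ℝ (Fin d) × EuclideanSpace ℝ (Fin d) =>
      a (q.1 + q.2, -q.2)) ν := hflip.integrable_comp_of_integrable haint
  rw [← integral_add haint haint2]
  refine integral_mono_ae (haint.add haint2) (integrable_dirichlet t ψ) ?_
  filter_upwards [hfst, hadd] with q h1 h2
  have h1' := h1.1
  have h2' := h2.1
  have key := sq_mul_sub_div_add_le (A := f q.1 + ε) (B := f (q.1 + q.2) + ε) (p := ψ q.1)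
    (q := ψ (q.1 + q.2)) (by positivity) (by positivity)
  simp only [ha, add_neg_cancel_right]
  simpa only [add_sub_add_right_eq_sub] using key

/-- Test with `min φ n` and `ε = 1 / (n + 1)`. By `le_logRatio` the integrand is at least `(ψ - U_t
ψ) / (ψ + ε) φ²` with `ψ = min φ n`, which is formally `φ² - φ U_t φ` in the limit, and that
integrates to half the form. -/
theorem dirichlet_le_supPhi (hM : Integrable M) {φ : L2} (hφ : 0 ≤ᵐ[volume] φ)
    (hφM : ∀ᵐ x, φ x ^ 2 = M x) {t : ℝ} (ht : 0 < t) :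
    ((S.dirichlet t φ / 2 : ℝ) : EReal) ≤ S.supPhi M t := by
  set k : ℕ → EuclideanSpace ℝ (Fin d) → ℝ := fun n x =>
    (min (φ x) n / (min (φ x) n + 1 / ((n : ℝ) + 1)) - if φ x ≤ n then 0 else 1) * M x with hk
  have hφm := (Lp.stronglyMeasurable φ).measurable
  have hUφ : 0 ≤ᵐ[volume] S.U t φ := avgLp_nonneg _ hφ
  have hε (n : ℕ) : 0 < 1 / ((n : ℝ) + 1) := by positivity
  have hcm (n : ℕ) : Measurable fun x =>
      (min (φ x) n / (min (φ x) n + 1 / ((n : ℝ) + 1)) - if φ x ≤ n then (0 : ℝ) else 1) := by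
    refine Measurable.sub (by fun_prop) (Measurable.ite ?_ measurable_const measurable_const)
    exact measurableSet_le hφm measurable_const
  have hcb (n : ℕ) : ∀ᵐ x, ‖min (φ x) n / (min (φ x) n + 1 / ((n : ℝ) + 1)) -
      if φ x ≤ n then (0 : ℝ) else 1‖ ≤ 1 := by
    filter_upwards [hφ] with x hx
    have hx : 0 ≤ φ x := hx
    have h0 : 0 ≤ min (φ x) n := le_min hx n.cast_nonneg
    have h1 := hε n
    have h2 : 0 ≤ min (φ x) n / (min (φ x) n + 1 / ((n : ℝ) + 1)) := by positivity
    have h3 : min (φ x) n / (min (φ x) n + 1 / ((n : ℝ) + 1)) ≤ 1 := by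
      rw [div_le_one (by positivity)]; linarith
    rw [Real.norm_eq_abs, abs_le]
    split_ifs <;> constructor <;> linarith
  have hkint (n : ℕ) : Integrable (k n) := hM.bdd_mul (hcm n).aestronglyMeasurable (hcb n)
  have hprod : Integrable (fun x => φ x * S.U t φ x) :=
    (Lp.memLp φ).integrable_mul (Lp.memLp (S.U t φ))
  have hle (n : ℕ) : (((∫ x, k n x) - ∫ x, φ x * S.U t φ x : ℝ) : EReal) ≤ S.supPhi M t := by
    have hmem := truncLp_mem_Icc n hφ
    have hUmem : ∀ᵐ x, S.U t (truncLp n φ) x ∈ Set.Icc 0 (n : ℝ) := avgLp_mem_Icc _ hmem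
    have htle : truncLp n φ ≤ᵐ[volume] φ := by
      filter_upwards [coeFn_truncLp n φ] with x hx
      rw [hx]; exact min_le_left _ _
    have hUle : S.U t (truncLp n φ) ≤ᵐ[volume] S.U t φ := avgLp_mono _ htle
    refine le_trans (EReal.coe_le_coe_iff.2 ?_) (le_supPhi_of_bounded hM hmem (hε n) ht)
    rw [← integral_sub (hkint n) hprod]
    refine integral_mono_ae ((hkint n).sub hprod) (integrable_logRatio_mul hM hmem hUmem (hε n)) ?_
    filter_upwards [hmem, hUmem, hUle, coeFn_truncLp n φ, hφ, hUφ, hφM] with x h1 h2 h3 h4 h5 h6 h7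
    have h5 : 0 ≤ φ x := h5
    have h6 : 0 ≤ S.U t φ x := h6
    have h8 := hε n
    have h9 := h2.1
    have hM0 : 0 ≤ M x := h7 ▸ sq_nonneg _
    refine le_trans ?_ (mul_le_mul_of_nonneg_right (le_logRatio h8 h1.1 h2.1) hM0)
    rw [h4]
    have h0 : 0 ≤ min (φ x) n := le_min h5 n.cast_nonneg
    -- Where `φ ≤ n`, the factor `φ² / (φ + ε)` is at most `φ`. Where `φ > n`, the quotient is at
    -- most `1`, and the loss `M x` is charged to the indicator in `k`, which disappears as `n → ∞`.
    have key : S.U t (truncLp n φ) x / (min (φ x) n + 1 / ((n : ℝ) + 1)) * M x ≤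
        φ x * S.U t φ x + (if φ x ≤ n then 0 else 1) * M x := by
      split_ifs with h
      · rw [min_eq_left h, ← h7, div_mul_eq_mul_div, div_le_iff₀ (by positivity)]
        have e1 : S.U t (truncLp n φ) x * φ x ^ 2 ≤ S.U t φ x * φ x ^ 2 := by gcongr
        have e2 : 0 ≤ φ x * S.U t φ x * (1 / ((n : ℝ) + 1)) := by positivity
        linarith [e1, e2]
      · have e1 : S.U t (truncLp n φ) x / (min (φ x) n + 1 / ((n : ℝ) + 1)) ≤ 1 := by
          rw [min_eq_right (not_le.1 h).le, div_le_one (by positivity)]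
          linarith [h2.2]
        have e2 : 0 ≤ φ x * S.U t φ x := by positivity
        have e3 := mul_le_mul_of_nonneg_right e1 hM0
        linarith
    simp only [hk]
    rw [sub_div, sub_mul, sub_mul]
    linarith
  have hlim : Tendsto (fun n => ∫ x, k n x) atTop (𝓝 (∫ x, M x)) := by
    refine tendsto_integral_of_dominated_convergence (fun x => |M x|) (fun n => (hkint n).1)
      hM.abs (fun n => ?_) ?_
    · filter_upwards [hcb n] with x hx
      rw [hk, norm_mul, Real.norm_eq_abs (M x)]
      exact mul_le_of_le_one_left (abs_nonneg _) hx
    · filter_upwards [hφ, hφM] with x h1 h2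
      have h1 : 0 ≤ φ x := h1
      rcases h1.eq_or_lt with h3 | h3
      · have : M x = 0 := by rw [← h2, ← h3]; simp
        simp [hk, this]
      · obtain ⟨N, hN⟩ := exists_nat_ge (φ x)
        have e1 : Tendsto (fun n : ℕ => (φ x / (φ x + 1 / ((n : ℝ) + 1)) - 0) * M x) atTop
            (𝓝 ((φ x / (φ x + 0) - 0) * M x)) := by
          refine ((Tendsto.div tendsto_const_nhds (tendsto_const_nhds.add
            tendsto_one_div_add_atTop_nhds_zero_nat) ?_).sub_const 0).mul_const _
          rw [add_zero]; exact h3.ne'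
        rw [add_zero, div_self h3.ne', sub_zero, one_mul] at e1
        refine e1.congr' ?_
        filter_upwards [eventually_ge_atTop N] with n hn
        have h4 : φ x ≤ n := hN.trans (by exact_mod_cast hn)
        simp only [hk, min_eq_left h4, if_pos h4]
  have heq : S.dirichlet t φ / 2 = (∫ x, M x) - ∫ x, φ x * S.U t φ x := by
    rw [dirichlet_eq, integral_congr_ae hφM]
    ring
  rw [heq]
  exact le_of_tendsto' (EReal.tendsto_coe.2 (hlim.sub_const _)) hle

/-- Pairing with a fixed `L²` weight is continuous, so `L²` convergence of the quotients suffices.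
-/
theorem tendsto_integral_quotient {f v : L2} (h : S.HasGen f v) {k : EuclideanSpace ℝ (Fin d) → ℝ}
    (hk : MemLp k 2 volume) :
    Tendsto (fun t : ℝ => t⁻¹ * ∫ x, (f x - S.U t f x) * k x) (𝓝[>] 0)
      (𝓝 (∫ x, -v x * k x)) := by
  have hin (g : L2) : inner ℝ hk.toLp g = ∫ x, g x * k x := by
    rw [L2.inner_def]
    refine integral_congr_ae ?_
    filter_upwards [hk.coeFn_toLp] with x hx
    rw [hx]; simp
  have h1 : Tendsto (fun t : ℝ => inner ℝ hk.toLp (t⁻¹ • (S.U t f - f))) (𝓝[>] 0)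
      (𝓝 (inner ℝ hk.toLp v)) := tendsto_const_nhds.inner h
  have h2 := h1.neg
  have e : -inner ℝ hk.toLp v = ∫ x, -v x * k x := by
    rw [hin, ← integral_neg]
    simp only [neg_mul]
  rw [e] at h2
  refine h2.congr fun t => ?_
  rw [real_inner_smul_right, hin, ← mul_neg, ← integral_neg]
  congr 1
  refine integral_congr_ae ?_
  filter_upwards [Lp.coeFn_sub (S.U t f) f] with x hx
  rw [hx, Pi.sub_apply]; ring

theorem eventually_lt_of_lt_rateFunctional (hM : Integrable M) (hM0 : ∀ x, 0 ≤ M x) {a : EReal}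
    (ha : a < S.rateFunctional M) :
    ∀ᶠ t in 𝓝[>] (0 : ℝ), a < ((1 / t : ℝ) : EReal) * S.supPhi M t := by
  simp only [rateFunctional, lt_iSup_iff] at ha
  obtain ⟨u, ⟨-, hu0, ⟨C, hC⟩, hudom⟩, ε, hε, ha⟩ := ha
  have hε : 0 < ε := hε
  obtain ⟨f, v, huf, hgen, huv⟩ := S.exists_hasGen hudom
  have hf : ∀ᵐ x, f x ∈ Set.Icc 0 C := by
    filter_upwards [huf] with x hx
    exact hx ▸ ⟨hu0 x, hC x⟩
  have hsq : MemLp (fun x => √(M x)) 2 volume := by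
    rw [memLp_two_iff_integrable_sq (Real.continuous_sqrt.comp_aestronglyMeasurable hM.1)]
    simpa only [Real.sq_sqrt (hM0 _)] using hM
  set φ : L2 := hsq.toLp with hφdef
  have hφ : 0 ≤ᵐ[volume] φ := by
    filter_upwards [hsq.coeFn_toLp] with x hx
    rw [hx]; exact Real.sqrt_nonneg _
  have hφM : ∀ᵐ x, φ x ^ 2 = M x := by
    filter_upwards [hsq.coeFn_toLp] with x hx
    rw [hx, Real.sq_sqrt (hM0 x)]
  set G : EuclideanSpace ℝ (Fin d) → ℝ := fun x => -v x / (f x + ε) with hG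
  have ha : a < extIntegral volume (fun x => G x * φ x ^ 2) := by
    refine ha.trans_eq (extIntegral_congr ?_)
    filter_upwards [huf, huv, hφM] with x h1 h2 h3
    rw [h1, h2, h3]
  have hfm := (Lp.stronglyMeasurable f).measurable
  have hGm : Measurable G := (Lp.stronglyMeasurable v).measurable.neg.div (hfm.add_const ε)
  set m : ℕ → EuclideanSpace ℝ (Fin d) → ℝ := fun n x => min (φ x) n ^ 2 with hm
  have hmm (n : ℕ) : Measurable (m n) :=
    ((Lp.stronglyMeasurable φ).measurable.min measurable_const).pow_const 2
  have hmono : ∀ᵐ x, ∀ n k : ℕ, n ≤ k → m n x ≤ m k x := by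
    filter_upwards [hφ] with x hx n k hnk
    have h0 : 0 ≤ min (φ x) n := le_min hx n.cast_nonneg
    have : (n : ℝ) ≤ k := by exact_mod_cast hnk
    simp only [hm]
    gcongr
  have hmle : ∀ᵐ x, ∀ n : ℕ, m n x ≤ φ x ^ 2 := by
    filter_upwards [hφ] with x hx n
    have h0 : 0 ≤ min (φ x) n := le_min hx n.cast_nonneg
    simp only [hm]
    gcongr
    exact min_le_left _ _
  have hlim : Tendsto (fun n => ∫⁻ x, ENNReal.ofReal (G x * m n x)) atTop
      (𝓝 (∫⁻ x, ENNReal.ofReal (G x * φ x ^ 2))) := by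
    refine lintegral_tendsto_of_tendsto_of_monotone
      (fun n => (hGm.mul (hmm n)).ennreal_ofReal.aemeasurable) ?_
      (Eventually.of_forall fun x => ?_)
    · filter_upwards [hmono] with x hx n k hnk
      rcases le_total 0 (G x) with h | h
      · exact ENNReal.ofReal_le_ofReal (mul_le_mul_of_nonneg_left (hx n k hnk) h)
      · dsimp only
        rw [ENNReal.ofReal_of_nonpos (mul_nonpos_of_nonpos_of_nonneg h (sq_nonneg _))]
        exact zero_le
    · obtain ⟨N, hN⟩ := exists_nat_ge (φ x)
      refine tendsto_const_nhds.congr' ?_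
      filter_upwards [eventually_ge_atTop N] with n hn
      simp only [hm]
      rw [min_eq_left (hN.trans (by exact_mod_cast hn))]
  set α := ∫⁻ x, ENNReal.ofReal (G x * φ x ^ 2) with hα
  set β := ∫⁻ x, ENNReal.ofReal (-(G x * φ x ^ 2)) with hβ
  have ha : a < (α : EReal) - (β : EReal) := ha
  -- An infinite negative part would make the difference `⊥`, which nothing is below; this covers
  -- the undefined integrals.
  have hβtop : β ≠ ∞ := by
    intro h
    rw [h] at ha
    simp at ha
  -- Only the positive part is truncated, by monotone convergence; the full negative part `β` stays
  -- and dominates the truncated one.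
  obtain ⟨n, hn⟩ : ∃ n : ℕ, a < ((∫⁻ x, ENNReal.ofReal (G x * m n x) : ℝ≥0∞) : EReal) - β := by
    have hcont : Tendsto (fun n => ((∫⁻ x, ENNReal.ofReal (G x * m n x) : ℝ≥0∞) : EReal) - β) atTop
        (𝓝 ((α : EReal) - β)) := by
      have hc : ContinuousAt (fun p : EReal × EReal => p.1 + p.2) ((α : EReal), -(β : EReal)) :=
        EReal.continuousAt_add (Or.inr (by simpa using hβtop))
          (Or.inl (EReal.coe_ennreal_ne_bot _))
      simp_rw [sub_eq_add_neg]
      exact hc.tendsto.comp (((continuous_coe_ennreal_ereal.tendsto α).comp hlim).prodMk_nhds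
        tendsto_const_nhds)
    exact (hcont.eventually_const_lt ha).exists
  have hψ := coeFn_truncLp n φ
  -- With `ψ = min φ n`, the weight is at most `(n / ε) ψ`, which lies in `L²`.
  have hkL : MemLp (fun x => m n x / (f x + ε)) 2 volume := by
    refine MemLp.of_le_mul (c := n / ε) (Lp.memLp (truncLp n φ))
      ((hmm n).div (hfm.add_const ε)).aestronglyMeasurable ?_
    filter_upwards [hψ, hf, truncLp_mem_Icc n hφ] with x h1 h2 h3
    have h2' := h2.1
    rw [h1] at h3 ⊢
    have h3' := h3.1
    rw [Real.norm_eq_abs, Real.norm_eq_abs, abs_of_nonneg (by positivity), abs_of_nonneg h3.1]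
    simp only [hm]
    rw [div_mul_eq_mul_div, sq]
    gcongr
    · exact h3.2
    · linarith
  have hint : Integrable (fun x => G x * m n x) := by
    refine ((Lp.memLp v).neg.integrable_mul hkL).congr (Eventually.of_forall fun x => ?_)
    simp only [hG, Pi.neg_apply, Pi.mul_apply]
    ring
  have hlt : a < ((∫ x, G x * m n x : ℝ) : EReal) := by
    rw [← extIntegral_of_integrable hint, extIntegral]
    refine hn.trans_le (EReal.sub_le_sub le_rfl ?_)
    rw [EReal.coe_ennreal_le_coe_ennreal_iff]
    refine lintegral_mono_ae ?_
    filter_upwards [hmle] with x hx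
    rcases le_total 0 (G x) with h | h
    · rw [ENNReal.ofReal_of_nonpos (neg_nonpos.2 (mul_nonneg h (sq_nonneg _)))]
      exact zero_le
    · exact ENNReal.ofReal_le_ofReal (neg_le_neg (mul_le_mul_of_nonpos_left (hx n) h))
  have hI : ∫ x, G x * m n x = ∫ x, -v x * (m n x / (f x + ε)) :=
    integral_congr_ae (Eventually.of_forall fun x => by simp only [hG]; ring)
  rw [hI] at hlt
  have hlim2 := EReal.tendsto_coe.2 (tendsto_integral_quotient hgen hkL)
  filter_upwards [hlim2.eventually_const_lt hlt, self_mem_nhdsWithin] with t h1 ht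
  have ht : 0 < t := ht
  refine h1.trans_le ?_
  rw [EReal.coe_mul, one_div]
  refine mul_le_mul_of_nonneg_left ?_ (by exact_mod_cast (inv_pos.2 ht).le)
  refine le_trans (EReal.coe_le_coe_iff.2 ?_) (dirichlet_le_supPhi hM hφ hφM ht)
  have h2 := two_mul_integral_le_dirichlet (S := S) (t := t) (ψ := truncLp n φ) hf hε
  have h3 := dirichlet_truncLp_le (S := S) t n φ
  have h4 : ∫ x, (f x - S.U t f x) * (m n x / (f x + ε)) =
      ∫ x, (f x - S.U t f x) / (f x + ε) * truncLp n φ x ^ 2 := by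
    refine integral_congr_ae ?_
    filter_upwards [hψ] with x hx
    rw [hx]
    ring
  rw [h4]
  linarith

/-! ### The marginal density and the conclusion. -/

theorem marginal_nonneg {c : ℝ} (hc : 0 < c) {prior : EuclideanSpace ℝ (Fin d) → ℝ}
    (h : ∀ θ, 0 ≤ prior θ) (x : EuclideanSpace ℝ (Fin d)) : 0 ≤ S.marginal c prior x :=
  integral_nonneg fun _ => mul_nonneg (S.density_nonneg c hc _) (h _)

theorem integrable_marginal {c : ℝ} (hc : 0 < c) {prior : EuclideanSpace ℝ (Fin d) → ℝ}
    (h : Integrable prior) : Integrable (S.marginal c prior) := by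
  refine (h.convolution_integrand (ContinuousLinearMap.mul ℝ ℝ)
    (S.integrable_density hc)).integral_prod_left.congr (Eventually.of_forall fun x => ?_)
  simp only [marginal, ContinuousLinearMap.mul_apply', mul_comm]

theorem inv_mul_supPhi_le (hM : Integrable M) (hM0 : ∀ x, 0 ≤ M x) {t : ℝ} (ht : 0 < t) :
    ((1 / t : ℝ) : EReal) * S.supPhi M t ≤ S.rateFunctional M := by
  rcases eq_or_ne (S.rateFunctional M) ⊤ with h | h
  · rw [h]; exact le_top
  have hbot : S.rateFunctional M ≠ ⊥ := by
    intro hb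
    have := rateFunctional_nonneg (S := S) (M := M)
    rw [hb] at this
    simp at this
  have hI := EReal.coe_toReal h hbot
  have h1 := supPhi_le hM hM0 hI.ge ht
  calc ((1 / t : ℝ) : EReal) * S.supPhi M t
      ≤ ((1 / t : ℝ) : EReal) * ((S.rateFunctional M).toReal * t : ℝ) :=
        mul_le_mul_of_nonneg_left h1 (by exact_mod_cast (one_div_pos.2 ht).le)
    _ = ((S.rateFunctional M).toReal : EReal) := by
        rw [← EReal.coe_mul]
        congr 1
        field_simp
    _ = _ := hI

end SymmConvSemigroup

end

theorem mainTheorem5 (d : ℕ) (S : SymmConvSemigroup d) (c : ℝ) (hc : 0 < c)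
    (prior : EuclideanSpace ℝ (Fin d) → ℝ) (prior_measurable : Measurable prior)
    (prior_nonneg : ∀ θ, 0 ≤ prior θ) (prior_integral : ∫ θ, prior θ = 1) :
    Tendsto
      (fun h : ℝ => ((1 / h : ℝ) : EReal) *
        ⨆ g ∈ S.domainNonneg, ⨆ ε ∈ Set.Ioi (0 : ℝ), S.phi (S.marginal c prior) h g ε)
      (𝓝[>] 0) (𝓝 (S.rateFunctional (S.marginal c prior))) := by
  have hprior : Integrable prior :=
    Integrable.of_integral_ne_zero (by rw [prior_integral]; exact one_ne_zero)
  have hM := SymmConvSemigroup.integrable_marginal (S := S) hc hprior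
  have hM0 := SymmConvSemigroup.marginal_nonneg (S := S) hc prior_nonneg
  refine tendsto_order.2 ⟨fun a ha =>
    SymmConvSemigroup.eventually_lt_of_lt_rateFunctional hM hM0 ha, fun a ha => ?_⟩
  filter_upwards [self_mem_nhdsWithin] with h hh
  exact (SymmConvSemigroup.inv_mul_supPhi_le hM hM0 hh).trans_lt ha
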